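/- Let $K$ be a field of characteristic zero, let $S=K[X_0,X_1,X_2]$ with its standard grading, let $P_1,\dots,P_s$ be distinct $K$-rational points of $\mathbb{P}^2$ with homogeneous vanishing ideals $I_{P_1},\dots,I_{P_s}\subseteq S$, and let $m_1,\dots,m_s$ be positive integers. Let $\mathbb{W}=m_1P_1+\cdots+m_sP_s$ be the fat point scheme in $\mathbb{P}^2$ defined by the ideal $I_{\mathbb{W}}=I_{P_1}^{m_1}\cap\cdots\cap I_{P_s}^{m_s}$, and let $R_{\mathbb{W}}=S/I_{\mathbb{W}}$ be its homogeneous coordinate ring. Let $\Omega^1_{R_{\mathbb{W}}/K}$ be the module of Kähler differentials of $R_{\mathbb{W}}/K$, graded so that the universal derivation $d$ is homogeneous of degree zero, and let $\Omega^k_{R_{\mathbb{W}}/K}=\bigwedge^k_{R_{\mathbb{W}}}\Omega^1_{R_{\mathbb{W}}/K}$ with the induced grading. For a graded module $M$ with finite-dimensional homogeneous components, its Hilbert polynomial $\mathrm{HP}_M(z)\in\mathbb{Q}[z]$ is the polynomial with $\mathrm{HP}_M(i)=\dim_K M_i$ for all sufficiently large $i$. Then the homogeneous components of $\Omega^k_{R_{\mathbb{W}}/K}$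 are finite-dimensional for $k=1,2,3$, and the Hilbert polynomials are the constants $$\mathrm{HP}_{\Omega^1_{R_{\mathbb{W}}/K}}(z)=\sum_{j=1}^s\tfrac12(3m_j-2)(m_j+1),$$ $$\mathrm{HP}_{\Omega^2_{R_{\mathbb{W}}/K}}(z)=\sum_{j=1}^s\tfrac12(3m_j+2)(m_j-1),$$ $$\mathrm{HP}_{\Omega^3_{R_{\mathbb{W}}/K}}(z)=\sum_{j=1}^s\tfrac12\,m_j(m_j-1).$$ -/

import Mathlib

open scoped LinearAlgebra.Projectivization

noncomputable section

namespace FatPoint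

/-- The homogeneous vanishing ideal in `K[X_0, …, X_n]` of a `K`-rational point of `ℙⁿ`: the ideal
generated by all homogeneous polynomials that vanish at the point. (Whether a homogeneous
polynomial vanishes does not depend on the chosen representative.) -/
def pointIdeal {K : Type*} [Field K] {n : ℕ} (P : ℙ K (Fin (n + 1) → K)) :
    Ideal (MvPolynomial (Fin (n + 1)) K) :=
  Ideal.span {F | (∃ d : ℕ, F.IsHomogeneous d) ∧ MvPolynomial.eval P.rep F = 0}

/-- The ideal `I_{P_1}^{m_1} ∩ ⋯ ∩ I_{P_s}^{m_s}` of the fat point scheme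
`m_1 P_1 + ⋯ + m_s P_s` in `ℙⁿ`. -/
def fatIdeal {K : Type*} [Field K] {n s : ℕ} (P : Fin s → ℙ K (Fin (n + 1) → K))
    (m : Fin s → ℕ) : Ideal (MvPolynomial (Fin (n + 1)) K) :=
  ⨅ j, pointIdeal (P j) ^ m j

/-- The homogeneous coordinate ring of the fat point scheme `m_1 P_1 + ⋯ + m_s P_s`. -/
abbrev CoordRing {K : Type*} [Field K] {n s : ℕ} (P : Fin s → ℙ K (Fin (n + 1) → K))
    (m : Fin s → ℕ) : Type _ :=
  MvPolynomial (Fin (n + 1)) K ⧸ fatIdeal P m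

/-- The homogeneous component of degree `d` of the coordinate ring: the residue classes of the
homogeneous polynomials of degree `d`. -/
def coordPiece {K : Type*} [Field K] {n s : ℕ} (P : Fin s → ℙ K (Fin (n + 1) → K))
    (m : Fin s → ℕ) (d : ℕ) : Submodule K (CoordRing P m) :=
  (MvPolynomial.homogeneousSubmodule (Fin (n + 1)) K d).map
    (Ideal.Quotient.mkₐ K (fatIdeal P m)).toLinearMap

/-- The homogeneous component of degree `d` of `Ω[R⁄K]`, for a `K`-algebra `R` with homogeneous
components `𝒜 i`: it is spanned by the elements `f • dg` with `f`, `g` homogeneous and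
`deg f + deg g = d`. It is also the image of the elements of degree `d` of the kernel of
`R ⊗ R → R`, and the universal derivation is homogeneous of degree zero. -/
def kaehlerPiece {K R : Type*} [Field K] [CommRing R] [Algebra K R] (𝒜 : ℕ → Submodule K R)
    (d : ℕ) : Submodule K (Ω[R⁄K]) :=
  Submodule.span K {ω | ∃ a b : ℕ, a + b = d ∧ ∃ f ∈ 𝒜 a, ∃ g ∈ 𝒜 b,
    ω = f • KaehlerDifferential.D K R g}

/-- The module `Ω^k` of Kähler differential `k`-forms: the `k`-th exterior power over `R` of the
module of Kähler differentials of `R` over `K`. -/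
abbrev KaehlerForms (K R : Type*) [Field K] [CommRing R] [Algebra K R] (k : ℕ) : Type _ :=
  ⋀[R]^k (Ω[R⁄K])

/-- The homogeneous component of degree `d` of `Ω^k`: it is spanned by the products
`ω_1 ∧ ⋯ ∧ ω_k` of homogeneous differentials with `deg ω_1 + ⋯ + deg ω_k = d`. -/
def formsPiece {K R : Type*} [Field K] [CommRing R] [Algebra K R] (𝒜 : ℕ → Submodule K R)
    (k d : ℕ) : Submodule K (KaehlerForms K R k) :=
  Submodule.span K {η | ∃ e : Fin k → ℕ, ∑ i, e i = d ∧
    ∃ ω : Fin k → Ω[R⁄K], (∀ i, ω i ∈ kaehlerPiece 𝒜 (e i)) ∧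
      η = exteriorPower.ιMulti R k ω}

/-- `p` is the Hilbert polynomial of the graded `K`-vector space with homogeneous components
`M d`: all components are finite dimensional, and `dim_K (M d) = p(d)` for all large `d`. -/
def IsHilbertPolynomial {K V : Type*} [Field K] [AddCommGroup V] [Module K V]
    (M : ℕ → Submodule K V) (p : Polynomial ℚ) : Prop :=
  (∀ d, FiniteDimensional K (M d)) ∧
    ∃ N : ℕ, ∀ d ≥ N, (Module.finrank K (M d) : ℚ) = p.eval (d : ℚ)

end FatPoint

end

/-! Write S for the polynomial ring. The k-forms of S/I are the free module on the products of k
distinct dX_i, modulo I times this module and modulo all products with a factor df, f ∈ I (`relMod`,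
`toForms_coordMap_eq_zero_iff`). Each dX_i has degree one, so the forms of degree d + k are the
classes of coefficient vectors of degree d, and `relDim` is their dimension (`finrank_formsPiece`).

In large degrees these dimensions add up over the points (`relDim_iInf`). Take forms e_j of a common
degree that vanish to order m_i + 1 at P_i for i ≠ j, but not at P_j. Since e df = d(ef) - f de,
multiplication by e_j carries relations at P_j to relations of the whole scheme. At P_j it is
bijective in large degrees: there every form is a multiple of e_j modulo the ideal at P_j, and the
dimensions are eventually constant. The sum of these multiplications identifies the direct sum of
the local pieces with the global one.

For one point, a linear change of coordinates leads to (1 : 0 : 0), with ideal p = (X_1, X_2) and m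
= a + 1. Here ∂_0 preserves the powers of p, while ∂_1 and ∂_2 lower the order by at most one. In
characteristic zero Euler's identity yields a Poincaré lemma: modulo p^(a+1), the pairs (v_1, v_2)
in p^a with ∂_2 v_1 - ∂_1 v_2 ∈ p^a are the pairs (∂_1 f, ∂_2 f) with f ∈ p^(a+1)
(`exists_grad_sub_mem`). This makes the relations explicit (`relMod_wedgeOne`, `relMod_wedgeTwo`,
`mem_relMod_wedgeThree`). With t(a) = a(a+1)/2, counting coefficients gives t(a+1) + 2t(a) + a,
3t(a) + a and t(a) for k = 1, 2, 3. -/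

noncomputable section

namespace FatPoint

open MvPolynomial

universe u

/-! ### Alternating maps and minors -/

/-- An alternating map that vanishes as soon as one argument lies in the kernel of a surjective
linear map `p` descends along `p`. -/
theorem exists_alternatingMap_descent {R M N V κ : Type*} [CommRing R] [AddCommGroup M] [Module R M]
    [AddCommGroup N] [Module R N] [AddCommGroup V] [Module R V] [Finite κ]
    (p : M →ₗ[R] N) (hp : Function.Surjective p) (g : M [⋀^κ]→ₗ[R] V)
    (hg : ∀ v i, p (v i) = 0 → g v = 0) :
    ∃ g' : N [⋀^κ]→ₗ[R] V, ∀ v, g' (fun i => p (v i)) = g v := by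
  classical
  have := Fintype.ofFinite κ
  -- Changing one argument at a time shows that `g` depends only on the images under `p`.
  have key : ∀ v w : κ → M, (∀ i, p (v i) = p (w i)) → g v = g w := by
    intro v w h
    suffices ∀ s : Finset κ, g (s.piecewise v w) = g w by simpa using this Finset.univ
    intro s
    induction s using Finset.induction_on with
    | empty => simp
    | insert i s hi ih =>
      rw [Finset.piecewise_insert, ← ih]
      have h0 : g (Function.update (s.piecewise v w) i (v i - w i)) = 0 :=
        hg _ i (by simp [h i])
      rw [g.map_update_sub, sub_eq_zero] at h0
      rw [h0]
      congr 1
      simp [hi]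
  let σ := Function.surjInv hp
  have hσ : ∀ n, p (σ n) = n := Function.surjInv_eq hp
  have hupd : ∀ (m : κ → N) (i : κ) (x : N) (y : M), p y = x →
      g (fun j => σ (Function.update m i x j)) = g (Function.update (fun j => σ (m j)) i y) := by
    intro m i x y hy
    apply key
    intro j
    rw [hσ]
    by_cases hj : j = i
    · subst hj; simp [hy]
    · simp [hj, hσ]
  refine ⟨⟨⟨fun n => g (fun i => σ (n i)), ?_, ?_⟩, ?_⟩, ?_⟩
  · intro inst m i x y
    have : inst = Classical.decEq κ := Subsingleton.elim _ _
    subst this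
    rw [hupd m i (x + y) (σ x + σ y) (by simp [hσ]), hupd m i x (σ x) (hσ x),
      hupd m i y (σ y) (hσ y), g.map_update_add]
  · intro inst m i c x
    have : inst = Classical.decEq κ := Subsingleton.elim _ _
    subst this
    rw [hupd m i (c • x) (c • σ x) (by simp [hσ]), hupd m i x (σ x) (hσ x), g.map_update_smul]
  · intro v i j hv hij
    exact g.map_eq_zero_of_eq _ (by simp only [hv]) hij
  · intro v
    exact key _ _ fun i => hσ _

/-- The alternating map sending `k` vectors to the minors with column families `b l`. -/
def minors (R : Type*) [CommRing R] {σ ι : Type*} {k : ℕ} (b : ι → Fin k → σ) :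
    (σ → R) [⋀^Fin k]→ₗ[R] (ι → R) :=
  AlternatingMap.pi fun l => Matrix.detRowAlternating.compLinearMap (LinearMap.funLeft R R (b l))

theorem minors_apply {R : Type*} [CommRing R] {σ ι : Type*} {k : ℕ} (b : ι → Fin k → σ)
    (v : Fin k → σ → R) (l : ι) :
    minors R b v l = Matrix.det (Matrix.of fun i j => v i (b l j)) := rfl

/-- `b` indexes a basis of the `k`-th exterior power of a free module with basis indexed by `σ`:
the minors of basis vectors are the unit vectors, and every alternating map is a linear
combination of minors. -/
structure IsWedgeBasis {σ ι : Type} [DecidableEq σ] [Fintype ι] [DecidableEq ι] {k : ℕ}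
    (b : ι → Fin k → σ) : Prop where
  minors_single : ∀ {R : Type u} [CommRing R] (l : ι),
    minors R b (fun i => Pi.single (b l i) 1) = Pi.single l 1
  eq_sum : ∀ {R : Type u} [CommRing R] {A : Type u} [AddCommGroup A] [Module R A]
    (h : (σ → R) [⋀^Fin k]→ₗ[R] A) (v : Fin k → σ → R),
    h v = ∑ l, minors R b v l • h (fun i => Pi.single (b l i) 1)

theorem minors_map {R R' : Type*} [CommRing R] [CommRing R'] {σ ι : Type*} {k : ℕ}
    (b : ι → Fin k → σ) (φ : R →+* R') (v : Fin k → σ → R) :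
    minors R' b (fun i j => φ (v i j)) = fun l => φ (minors R b v l) := by
  ext l
  rw [minors_apply, minors_apply, RingHom.map_det]
  rfl

/-! ### Gradients and the module of relations -/

section Basic

variable {K : Type*} [Field K] {σ : Type*}

/-- The gradient of a polynomial. -/
def grad (f : MvPolynomial σ K) : σ → MvPolynomial σ K := fun i => pderiv i f

theorem grad_mul (f g : MvPolynomial σ K) : grad (f * g) = f • grad g + g • grad f := by
  ext1 i; simp [grad]

theorem grad_add (f g : MvPolynomial σ K) : grad (f + g) = grad f + grad g := by
  ext1 i; simp [grad]

theorem grad_sub (f g : MvPolynomial σ K) : grad (f - g) = grad f - grad g := by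
  ext1 i; simp [grad]

theorem grad_smul (c : K) (f : MvPolynomial σ K) : grad (c • f) = c • grad f := by
  ext1 i; simp [grad]

theorem grad_X [DecidableEq σ] (i : σ) : grad (X i : MvPolynomial σ K) = Pi.single i 1 := by
  ext1 j; simp [grad, pderiv_X, Pi.single_apply, eq_comm]

/-- Vectors of homogeneous polynomials of degree `d`. -/
def homVec (K : Type*) [Field K] (σ ι : Type*) (d : ℕ) : Submodule K (ι → MvPolynomial σ K) :=
  Submodule.pi Set.univ fun _ => homogeneousSubmodule σ K d

theorem mem_homVec {ι : Type*} {d : ℕ} {v : ι → MvPolynomial σ K} :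
    v ∈ homVec K σ ι d ↔ ∀ i, (v i).IsHomogeneous d := by
  simp [homVec, Submodule.mem_pi]

instance homVec_finite {ι : Type*} [Finite σ] [Finite ι] (d : ℕ) :
    FiniteDimensional K (homVec K σ ι d) := by
  have := Fintype.ofFinite ι
  have hd : FiniteDimensional K (homogeneousSubmodule σ K d) :=
    Module.Finite.iff_fg.mpr (homogeneousSubmodule_fg _ _ d)
  let f : homVec K σ ι d →ₗ[K] (ι → homogeneousSubmodule σ K d) :=
    LinearMap.pi fun i => LinearMap.codRestrict _
      ((LinearMap.proj i).comp (homVec K σ ι d).subtype) fun v => v.2 i trivial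
  refine Module.Finite.of_injective f fun v w h => ?_
  ext1; ext1 i
  exact congrArg Subtype.val (congrFun h i)

theorem minors_mem_homVec {ι : Type*} {k : ℕ} (b : ι → Fin k → σ) (e : Fin k → ℕ)
    (v : Fin k → σ → MvPolynomial σ K) (hv : ∀ i, v i ∈ homVec K σ σ (e i)) :
    minors _ b v ∈ homVec K σ ι (∑ i, e i) := by
  rw [mem_homVec]
  intro l
  rw [minors_apply, Matrix.det_apply]
  refine IsHomogeneous.sum _ _ _ fun τ _ => ?_
  have : (∏ i, v (τ i) (b l i)).IsHomogeneous (∑ i, e (τ i)) :=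
    IsHomogeneous.prod _ _ _ fun i _ => mem_homVec.1 (hv (τ i)) _
  rw [Equiv.sum_comp τ e] at this
  have h2 : (∏ i, v (τ i) (b l i)) ∈ homogeneousSubmodule σ K (∑ i, e i) := this
  exact (Submodule.smul_of_tower_mem _ (Equiv.Perm.sign τ) h2)

/-- The relations of the exterior power `Ω^k` of `S/I`, in the coordinates given by the minors `b`:
vectors with entries in `I`, and the wedge products having a factor `df` with `f ∈ I`. -/
def relMod {ι : Type*} {k : ℕ} (b : ι → Fin k → σ) (I : Ideal (MvPolynomial σ K)) :
    Submodule (MvPolynomial σ K) (ι → MvPolynomial σ K) :=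
  Submodule.pi Set.univ (fun _ => I) ⊔
    Submodule.span _ {w | ∃ v i f, f ∈ I ∧ v i = grad f ∧ w = minors _ b v}

theorem mem_relMod_of_forall_mem {ι : Type*} {k : ℕ} {b : ι → Fin k → σ}
    {I : Ideal (MvPolynomial σ K)} {v : ι → MvPolynomial σ K} (hv : ∀ l, v l ∈ I) :
    v ∈ relMod b I :=
  Submodule.mem_sup_left fun l _ => hv l

theorem minors_mem_relMod {ι : Type*} {k : ℕ} {b : ι → Fin k → σ}
    {I : Ideal (MvPolynomial σ K)} {v : Fin k → σ → MvPolynomial σ K} {i : Fin k}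
    {f : MvPolynomial σ K} (hf : f ∈ I) (hv : v i = grad f) : minors _ b v ∈ relMod b I :=
  Submodule.mem_sup_right (Submodule.subset_span ⟨v, i, f, hf, hv, rfl⟩)

theorem relMod_le {ι : Type*} {k : ℕ} {b : ι → Fin k → σ} {I : Ideal (MvPolynomial σ K)}
    {N : Submodule (MvPolynomial σ K) (ι → MvPolynomial σ K)}
    (h1 : ∀ v : ι → MvPolynomial σ K, (∀ l, v l ∈ I) → v ∈ N)
    (h2 : ∀ v i f, f ∈ I → v i = grad f → minors _ b v ∈ N) : relMod b I ≤ N := by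
  refine sup_le (fun v hv => h1 v fun l => hv l trivial) (Submodule.span_le.2 ?_)
  rintro _ ⟨v, i, f, hf, hv, rfl⟩
  exact h2 v i f hf hv

theorem minors_apply_mem {R : Type*} [CommRing R] {ι : Type*} {k : ℕ} (b : ι → Fin k → σ)
    {I : Ideal R} {v : Fin k → σ → R} {i : Fin k} (hv : ∀ j, v i j ∈ I) (l : ι) :
    minors R b v l ∈ I := by
  rw [minors_apply, Matrix.det_apply]
  refine Submodule.sum_mem _ fun τ _ => ?_
  refine Submodule.smul_of_tower_mem _ _ ?_
  refine Ideal.mem_of_dvd _ (Finset.dvd_prod_of_mem _ (Finset.mem_univ (τ.symm i))) ?_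
  simpa using hv _

end Basic

/-! ### Presentation of differential forms by generators and relations -/

section Presentation

variable {K : Type u} [Field K] {σ : Type} {R : Type u} [CommRing R] [Algebra K R]

/-- Entrywise application of a ring homomorphism to vectors. -/
def coordMap {S R : Type*} [CommRing S] [CommRing R] (φ : S →+* R) (ι : Type*) :
    (ι → S) →ₛₗ[φ] (ι → R) where
  toFun v l := φ (v l)
  map_add' v w := by ext; simp
  map_smul' c v := by ext; simp

@[simp] theorem coordMap_apply {S R : Type*} [CommRing S] [CommRing R] (φ : S →+* R) {ι : Type*}
    (v : ι → S) (l : ι) : coordMap φ ι v l = φ (v l) := rfl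

theorem coordMap_smul {S R : Type*} [CommRing S] [CommRing R] (φ : S →+* R) {ι : Type*}
    (c : S) (v : ι → S) : coordMap φ ι (c • v) = φ c • coordMap φ ι v :=
  LinearMap.map_smulₛₗ _ c v

theorem coordMap_surjective {S R : Type*} [CommRing S] [CommRing R] {φ : S →+* R} (ι : Type*)
    (h : Function.Surjective φ) : Function.Surjective (coordMap φ ι) := by
  intro w
  choose v hv using fun l => h (w l)
  exact ⟨v, funext hv⟩

theorem coordMap_single {S R : Type*} [CommRing S] [CommRing R] (φ : S →+* R) {ι : Type*}
    [DecidableEq ι] (l : ι) (a : S) : coordMap φ ι (Pi.single l a) = Pi.single l (φ a) := by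
  ext j
  by_cases h : j = l
  · subst h; simp
  · simp [h]

theorem coordMap_minors {S R : Type*} [CommRing S] [CommRing R] (φ : S →+* R) {ι : Type*}
    {k : ℕ} (b : ι → Fin k → σ) (v : Fin k → σ → S) :
    coordMap φ ι (minors S b v) = minors R b (fun i => coordMap φ σ (v i)) :=
  (minors_map b φ v).symm

variable (π : MvPolynomial σ K →ₐ[K] R)

/-- The `R`-module generated by the images of the gradients of the kernel of `π`. -/
def gradMod : Submodule R (σ → R) :=
  Submodule.span R {w | ∃ f, π f = 0 ∧ w = coordMap (π : _ →+* R) σ (grad f)}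

/-- The linear map from `R ^ σ` to the Kähler differentials given by the differentials of the
images of the variables. -/
def toKaehler [Fintype σ] : (σ → R) →ₗ[R] Ω[R⁄K] :=
  Fintype.linearCombination R fun i => KaehlerDifferential.D K R (π (X i))

theorem toKaehler_apply [Fintype σ] (v : σ → R) :
    toKaehler π v = ∑ i, v i • KaehlerDifferential.D K R (π (X i)) := rfl

theorem toKaehler_single [Fintype σ] [DecidableEq σ] (i : σ) :
    toKaehler π (Pi.single i 1) = KaehlerDifferential.D K R (π (X i)) := by
  simp [toKaehler, Fintype.linearCombination_apply_single]

theorem toKaehler_grad [Fintype σ] (f : MvPolynomial σ K) :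
    toKaehler π (coordMap (π : _ →+* R) σ (grad f)) = KaehlerDifferential.D K R (π f) := by
  classical
  induction f using MvPolynomial.induction_on with
  | C a =>
    have h0 : grad (C a : MvPolynomial σ K) = 0 := by ext1 i; simp [grad]
    have h1 : π (C a) = algebraMap K R a := π.commutes a
    rw [h0, map_zero, map_zero, h1, Derivation.map_algebraMap]
  | add p q hp hq => rw [grad_add, map_add, map_add, hp, hq, map_add, map_add]
  | mul_X p i hp =>
    rw [grad_mul, map_add, map_add, coordMap_smul, coordMap_smul, map_smul,
      map_smul, hp, grad_X, coordMap_single, map_one, toKaehler_single, map_mul,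
      Derivation.leibniz]
    rfl

variable {π}

theorem mkQ_coordMap_grad_eq {f g : MvPolynomial σ K} (h : π f = π g) :
    (gradMod π).mkQ (coordMap (π : _ →+* R) σ (grad f)) =
      (gradMod π).mkQ (coordMap (π : _ →+* R) σ (grad g)) := by
  rw [← sub_eq_zero, ← map_sub, ← map_sub, ← grad_sub, Submodule.mkQ_apply,
    Submodule.Quotient.mk_eq_zero]
  exact Submodule.subset_span ⟨f - g, by simp [h], rfl⟩

theorem toKaehler_surjective [Fintype σ] (hπ : Function.Surjective π) :
    Function.Surjective (toKaehler π) := by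
  rw [← LinearMap.range_eq_top, eq_top_iff, ← KaehlerDifferential.span_range_derivation,
    Submodule.span_le]
  rintro _ ⟨r, rfl⟩
  obtain ⟨f, rfl⟩ := hπ r
  exact ⟨_, toKaehler_grad π f⟩

/-- Sending r to the gradient of a lift is well defined modulo `gradMod π` and is a derivation. The
linear map it induces on differentials, composed with `toKaehler π`, is the quotient map, which
bounds the kernel from above. -/
theorem ker_toKaehler [Fintype σ] (hπ : Function.Surjective π) :
    LinearMap.ker (toKaehler π) = gradMod π := by
  classical
  apply le_antisymm
  · let s := Function.surjInv hπ
    have hs : ∀ r, π (s r) = r := Function.surjInv_eq hπ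
    let δ₀ : R →ₗ[K] (σ → R) ⧸ gradMod π :=
      { toFun := fun r => (gradMod π).mkQ (coordMap (π : _ →+* R) σ (grad (s r)))
        map_add' := fun x y => by
          rw [← map_add, ← map_add, ← grad_add]
          exact mkQ_coordMap_grad_eq (by simp [hs])
        map_smul' := fun c x => by
          have : c • (gradMod π).mkQ (coordMap (π : _ →+* R) σ (grad (s x))) =
              (gradMod π).mkQ (coordMap (π : _ →+* R) σ (grad (c • s x))) := by
            rw [grad_smul, ← algebraMap_smul R c, ← map_smul]
            congr 1
            ext i
            simp [Algebra.smul_def]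
          rw [RingHom.id_apply, this]
          exact mkQ_coordMap_grad_eq (by simp [hs]) }
    have hδ₀ : ∀ f, δ₀ (π f) = (gradMod π).mkQ (coordMap (π : _ →+* R) σ (grad f)) :=
      fun f => mkQ_coordMap_grad_eq (hs _)
    let δ : Derivation K R ((σ → R) ⧸ gradMod π) := Derivation.mk' δ₀ fun x y => by
      obtain ⟨f, rfl⟩ := hπ x
      obtain ⟨g, rfl⟩ := hπ y
      rw [← map_mul, hδ₀, hδ₀, hδ₀, grad_mul, map_add, map_add, coordMap_smul,
        coordMap_smul, map_smul, map_smul]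
      rfl
    have hcomp : δ.liftKaehlerDifferential ∘ₗ toKaehler π = (gradMod π).mkQ := by
      refine (Pi.basisFun R σ).ext fun i => ?_
      rw [LinearMap.comp_apply, Pi.basisFun_apply, toKaehler_single,
        Derivation.liftKaehlerDifferential_comp_D]
      change δ₀ _ = _
      rw [hδ₀, grad_X, coordMap_single, map_one]
    intro v hv
    rw [← Submodule.ker_mkQ (gradMod π), ← hcomp]
    simp [LinearMap.mem_ker.1 hv]
  · rw [gradMod, Submodule.span_le]
    rintro _ ⟨f, hf, rfl⟩
    simp [toKaehler_grad, hf]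

variable {ι : Type} [Fintype ι] {k : ℕ} (b : ι → Fin k → σ) (π)

/-- The linear map from vectors indexed by `ι` to `Ω^k` given by the products of the differentials
of the images of the variables. -/
def toForms : (ι → R) →ₗ[R] KaehlerForms K R k :=
  Fintype.linearCombination R fun l =>
    exteriorPower.ιMulti R k fun i => KaehlerDifferential.D K R (π (X (b l i)))

theorem toForms_apply (v : ι → R) : toForms π b v =
    ∑ l, v l • exteriorPower.ιMulti R k fun i => KaehlerDifferential.D K R (π (X (b l i))) := rfl

variable {b} [Fintype σ] [DecidableEq σ] [DecidableEq ι]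

theorem toForms_minors (hb : IsWedgeBasis.{u} b) (v : Fin k → σ → R) :
    toForms π b (minors R b v) = exteriorPower.ιMulti R k fun i => toKaehler π (v i) := by
  have := hb.eq_sum ((exteriorPower.ιMulti R k).compLinearMap (toKaehler π)) v
  simp only [AlternatingMap.compLinearMap_apply, toKaehler_single] at this
  rw [toForms_apply]
  exact this.symm

variable {π}

/-- Modulo the right-hand side, the minors vanish as soon as one argument is in the kernel of
`toKaehler π`, so they descend to an alternating map on differentials. The induced map on k-forms
composed with `toForms π b` is again the quotient map. -/
theorem ker_toForms (hπ : Function.Surjective π) (hb : IsWedgeBasis.{u} b) :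
    LinearMap.ker (toForms π b) =
      Submodule.span R {w | ∃ v i, v i ∈ gradMod π ∧ w = minors R b v} := by
  set N := Submodule.span R {w | ∃ v i, v i ∈ gradMod π ∧ w = minors R b v}
  apply le_antisymm
  · obtain ⟨g, hg⟩ := exists_alternatingMap_descent (toKaehler π) (toKaehler_surjective hπ)
      (N.mkQ.compAlternatingMap (minors R b)) (by
        intro v i hv
        rw [LinearMap.compAlternatingMap_apply, Submodule.mkQ_apply,
          Submodule.Quotient.mk_eq_zero]
        rw [← LinearMap.mem_ker, ker_toKaehler hπ] at hv
        exact Submodule.subset_span ⟨v, i, hv, rfl⟩)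
    have hcomp : exteriorPower.alternatingMapLinearEquiv g ∘ₗ toForms π b = N.mkQ := by
      refine (Pi.basisFun R ι).ext fun l => ?_
      rw [LinearMap.comp_apply, Pi.basisFun_apply, ← hb.minors_single, toForms_minors π hb,
        exteriorPower.alternatingMapLinearEquiv_apply_ιMulti, hg]
      rfl
    intro v hv
    rw [← Submodule.ker_mkQ N, ← hcomp]
    simp [LinearMap.mem_ker.1 hv]
  · rw [Submodule.span_le]
    rintro _ ⟨v, i, hv, rfl⟩
    rw [← ker_toKaehler hπ] at hv
    simp only [SetLike.mem_coe, LinearMap.mem_ker, toForms_minors π hb]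
    exact AlternatingMap.map_coord_zero _ i hv

end Presentation

/-! ### Graded pieces of the modules of forms -/

section Pieces

variable {K : Type u} [Field K] {σ : Type} {R : Type u} [CommRing R] [Algebra K R]
  (π : MvPolynomial σ K →ₐ[K] R)

/-- The entrywise application of an algebra homomorphism, as a linear map over the base field. -/
def coordMapK (ι : Type*) : (ι → MvPolynomial σ K) →ₗ[K] (ι → R) :=
  LinearMap.pi fun l => π.toLinearMap ∘ₗ LinearMap.proj l

theorem coordMapK_apply {ι : Type*} (v : ι → MvPolynomial σ K) :
    coordMapK π ι v = coordMap (π : _ →+* R) ι v := rfl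

/-- The graded pieces that `R` inherits from the polynomial ring. -/
def imagePiece (d : ℕ) : Submodule K R :=
  (homogeneousSubmodule σ K d).map π.toLinearMap

variable {π}

/-- Lifts a relation over `R` to one over the polynomial ring, by induction on the slot that lies in
`gradMod π`. -/
theorem minors_update_mem_map_relMod (hπ : Function.Surjective π) {ι : Type} {k : ℕ}
    (b : ι → Fin k → σ) {i : Fin k} {w : σ → R} (hw : w ∈ gradMod π) (v : Fin k → σ → R) :
    ∃ u ∈ relMod b (RingHom.ker π),
      coordMap (π : _ →+* R) ι u = minors R b (Function.update v i w) := by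
  induction hw using Submodule.span_induction with
  | mem w hw =>
    obtain ⟨f, hf, rfl⟩ := hw
    choose u hu using fun j => coordMap_surjective (φ := (π : MvPolynomial σ K →+* R)) σ hπ (v j)
    refine ⟨minors _ b (Function.update u i (grad f)),
      minors_mem_relMod (i := i) (f := f) hf (by simp), ?_⟩
    rw [coordMap_minors]
    congr 1
    ext1 j
    by_cases h : j = i
    · subst h; simp
    · simp [h, hu]
  | zero => exact ⟨0, zero_mem _, by rw [map_zero, AlternatingMap.map_update_zero]⟩
  | add x y _ _ hx hy =>
    obtain ⟨a, ha, ha'⟩ := hx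
    obtain ⟨c, hc, hc'⟩ := hy
    exact ⟨a + c, add_mem ha hc, by rw [map_add, AlternatingMap.map_update_add, ha', hc']⟩
  | smul r x _ hx =>
    obtain ⟨a, ha, ha'⟩ := hx
    obtain ⟨s, rfl⟩ := hπ r
    exact ⟨s • a, Submodule.smul_mem _ _ ha, by
      rw [coordMap_smul, AlternatingMap.map_update_smul, ha']; rfl⟩

theorem isHomogeneous_zero_grad {G : MvPolynomial σ K} (hG : G.IsHomogeneous 0) :
    grad G = 0 := by
  rw [← totalDegree_zero_iff_isHomogeneous, totalDegree_eq_zero_iff_eq_C] at hG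
  rw [hG]
  ext1 i
  simp [grad]

variable [Fintype σ]

theorem kaehlerPiece_zero : kaehlerPiece (imagePiece π) 0 = ⊥ := by
  rw [kaehlerPiece, Submodule.span_eq_bot]
  rintro _ ⟨a, c, hac, f, -, _, ⟨G, hG, rfl⟩, rfl⟩
  obtain rfl : c = 0 := by omega
  have := toKaehler_grad π G
  rw [isHomogeneous_zero_grad hG, map_zero, map_zero] at this
  rw [AlgHom.toLinearMap_apply, ← this, smul_zero]

/-- The shift by one is the degree of dX_i. Degree zero is separate because constants have zero
differential. -/
theorem kaehlerPiece_succ (d : ℕ) : kaehlerPiece (imagePiece π) (d + 1) =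
    (homVec K σ σ d).map ((toKaehler π).restrictScalars K ∘ₗ coordMapK π σ) := by
  apply le_antisymm
  · rw [kaehlerPiece, Submodule.span_le]
    rintro _ ⟨a, c, hac, _, ⟨F, hF, rfl⟩, _, ⟨G, hG, rfl⟩, rfl⟩
    refine ⟨F • grad G, ?_, ?_⟩
    · rcases c with _ | c
      · rw [isHomogeneous_zero_grad hG, smul_zero]
        exact zero_mem _
      · refine mem_homVec.2 fun i => ?_
        obtain rfl : d = a + c := by omega
        exact IsHomogeneous.mul hF (IsHomogeneous.pderiv hG)
    · rw [LinearMap.comp_apply, coordMapK_apply, LinearMap.restrictScalars_apply, coordMap_smul,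
        map_smul, toKaehler_grad]
      rfl
  · rintro _ ⟨v, hv, rfl⟩
    rw [LinearMap.comp_apply, coordMapK_apply, LinearMap.restrictScalars_apply, toKaehler_apply]
    refine Submodule.sum_mem _ fun i _ => Submodule.subset_span ⟨d, 1, rfl, _,
      ⟨v i, mem_homVec.1 hv i, rfl⟩, _, ⟨X i, isHomogeneous_X _ _, rfl⟩, rfl⟩

theorem kaehlerPiece_finite (d : ℕ) : FiniteDimensional K (kaehlerPiece (imagePiece π) d) := by
  rcases d with _ | d
  · rw [kaehlerPiece_zero]
    infer_instance
  · rw [kaehlerPiece_succ]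
    infer_instance

variable {k : ℕ}

theorem formsPiece_eq_bot {d : ℕ} (h : d < k) : formsPiece (imagePiece π) k d = ⊥ := by
  rw [formsPiece, Submodule.span_eq_bot]
  rintro _ ⟨e, he, ω, hω, rfl⟩
  obtain ⟨i, hi⟩ : ∃ i, e i = 0 := by
    by_contra! hne
    have : ∑ _i : Fin k, 1 ≤ ∑ i, e i :=
      Finset.sum_le_sum fun i _ => Nat.one_le_iff_ne_zero.2 (hne i)
    simp at this
    omega
  have h0 := hω i
  rw [hi, kaehlerPiece_zero, Submodule.mem_bot] at h0
  exact AlternatingMap.map_coord_zero _ i h0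

variable [DecidableEq σ] {ι : Type} [Fintype ι] {b : ι → Fin k → σ}

variable [DecidableEq ι]

theorem toForms_coordMap_eq_zero_iff (hπ : Function.Surjective π) (hb : IsWedgeBasis.{u} b)
    (v : ι → MvPolynomial σ K) :
    toForms π b (coordMap (π : _ →+* R) ι v) = 0 ↔
      v ∈ relMod b (RingHom.ker π) := by
  have : RingHomSurjective (π : MvPolynomial σ K →+* R) := ⟨hπ⟩
  rw [← LinearMap.mem_ker, ker_toForms hπ hb]
  constructor
  · intro hv
    have hle : Submodule.span R {w | ∃ v i, v i ∈ gradMod π ∧ w = minors R b v} ≤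
        (relMod b (RingHom.ker π)).map (coordMap (π : _ →+* R) ι) := by
      rw [Submodule.span_le]
      rintro _ ⟨v, i, hv, rfl⟩
      obtain ⟨u, hu, hu'⟩ := minors_update_mem_map_relMod hπ b (i := i) hv v
      exact ⟨u, hu, by rw [hu', Function.update_eq_self]⟩
    obtain ⟨u, hu, huv⟩ := hle hv
    rw [← sub_add_cancel v u]
    refine add_mem (mem_relMod_of_forall_mem fun l => ?_) hu
    have : π (u l) = π (v l) := congrFun huv l
    rw [RingHom.mem_ker, Pi.sub_apply, map_sub, this, sub_self]
  · intro hv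
    have hle : relMod b (RingHom.ker π) ≤
        (Submodule.span R {w | ∃ v i, v i ∈ gradMod π ∧ w = minors R b v}).comap
          (coordMap (π : _ →+* R) ι) := by
      refine relMod_le (fun v hv => ?_) fun v i f hf hv => ?_
      · have : coordMap (π : _ →+* R) ι v = 0 := funext hv
        rw [Submodule.mem_comap, this]
        exact zero_mem _
      · rw [Submodule.mem_comap, coordMap_minors]
        refine Submodule.subset_span ⟨_, i, ?_, rfl⟩
        exact Submodule.subset_span ⟨f, hf, by rw [hv]⟩
    exact hle hv

theorem formsPiece_add (hk : 0 < k) (hb : IsWedgeBasis.{u} b) (d : ℕ) :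
    formsPiece (imagePiece π) k (d + k) =
      (homVec K σ ι d).map ((toForms π b).restrictScalars K ∘ₗ coordMapK π ι) := by
  apply le_antisymm
  · rw [formsPiece, Submodule.span_le]
    rintro _ ⟨e, he, ω, hω, rfl⟩
    by_cases hne : ∃ i, e i = 0
    · obtain ⟨i, hi⟩ := hne
      have h0 := hω i
      rw [hi, kaehlerPiece_zero, Submodule.mem_bot] at h0
      rw [AlternatingMap.map_coord_zero _ i h0]
      exact zero_mem _
    · push Not at hne
      choose e' he' using fun i => Nat.exists_eq_succ_of_ne_zero (hne i)
      have hω' : ∀ i, ∃ v ∈ homVec K σ σ (e' i),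
          toKaehler π (coordMap (π : _ →+* R) σ v) = ω i := by
        intro i
        have := hω i
        rw [he', Nat.succ_eq_add_one, kaehlerPiece_succ] at this
        exact this
      choose v hv hv' using hω'
      have hd : ∑ i, e' i = d := by
        simp only [he', Nat.succ_eq_add_one, Finset.sum_add_distrib] at he
        simpa using he
      refine ⟨minors _ b v, hd ▸ minors_mem_homVec b e' v hv, ?_⟩
      rw [LinearMap.comp_apply, coordMapK_apply, LinearMap.restrictScalars_apply,
        coordMap_minors, toForms_minors π hb]
      simp only [hv']
  · rintro _ ⟨v, hv, rfl⟩
    rw [LinearMap.comp_apply, coordMapK_apply, LinearMap.restrictScalars_apply, toForms_apply]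
    refine Submodule.sum_mem _ fun l _ => Submodule.subset_span ?_
    let i₀ : Fin k := ⟨0, hk⟩
    let D := fun i => KaehlerDifferential.D K R (π (X (b l i)))
    have hD : ∀ i, ∀ a, ∀ F : MvPolynomial σ K, F.IsHomogeneous a →
        π F • D i ∈ kaehlerPiece (imagePiece π) (a + 1) := fun i a F hF =>
      Submodule.subset_span ⟨a, 1, rfl, _, ⟨F, hF, rfl⟩, _, ⟨X _, isHomogeneous_X _ _, rfl⟩, rfl⟩
    -- The whole coefficient is absorbed into the factor of index 0, which exists because `k` is
    -- positive.
    refine ⟨fun i => if i = i₀ then d + 1 else 1, ?_,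
      Function.update D i₀ (π (v l) • D i₀), fun i => ?_, ?_⟩
    · rw [← Finset.add_sum_erase _ _ (Finset.mem_univ i₀), if_pos rfl,
        Finset.sum_congr rfl fun i hi => if_neg (Finset.ne_of_mem_erase hi)]
      simp
      omega
    · by_cases h : i = i₀
      · subst h
        simpa using hD i₀ d _ (mem_homVec.1 hv l)
      · have := hD i 0 1 (isHomogeneous_one _ _)
        simpa [h] using this
    · rw [AlternatingMap.map_update_smul, Function.update_eq_self]
      rfl

/-- The dimension of the piece of degree `d` of the module with relations `relMod b I`. -/
def relDim {K : Type*} [Field K] {σ ι : Type*} {k : ℕ} (b : ι → Fin k → σ)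
    (I : Ideal (MvPolynomial σ K)) (d : ℕ) : ℕ :=
  Module.finrank K ((homVec K σ ι d).map ((relMod b I).mkQ.restrictScalars K))

theorem finrank_map_add_finrank_inf_ker {K V V' : Type*} [Field K] [AddCommGroup V] [Module K V]
    [AddCommGroup V'] [Module K V'] (f : V →ₗ[K] V') (W : Submodule K V) [FiniteDimensional K W] :
    Module.finrank K (W.map f) + Module.finrank K (W ⊓ LinearMap.ker f : Submodule K V) =
      Module.finrank K W := by
  rw [← (f.domRestrict W).finrank_range_add_finrank_ker, LinearMap.range_domRestrict,
    LinearMap.ker_domRestrict]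
  congr 1
  rw [← LinearEquiv.finrank_eq (Submodule.comapSubtypeEquivOfLe
    (inf_le_left : W ⊓ LinearMap.ker f ≤ W)), Submodule.comap_inf, Submodule.comap_subtype_self,
    top_inf_eq]

theorem finrank_map_eq_of_ker_eq {K V V' V'' : Type*} [Field K] [AddCommGroup V] [Module K V]
    [AddCommGroup V'] [Module K V'] [AddCommGroup V''] [Module K V'']
    (f : V →ₗ[K] V') (g : V →ₗ[K] V'') (h : LinearMap.ker f = LinearMap.ker g)
    (W : Submodule K V) [FiniteDimensional K W] :
    Module.finrank K (W.map f) = Module.finrank K (W.map g) := by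
  have hf := finrank_map_add_finrank_inf_ker f W
  have hg := finrank_map_add_finrank_inf_ker g W
  rw [h] at hf
  omega

theorem formsPiece_finite (hk : 0 < k) (hb : IsWedgeBasis.{u} b) (d : ℕ) :
    FiniteDimensional K (formsPiece (imagePiece π) k d) := by
  rcases lt_or_ge d k with h | h
  · rw [formsPiece_eq_bot h]
    infer_instance
  · obtain ⟨d, rfl⟩ := Nat.exists_eq_add_of_le' h
    rw [formsPiece_add hk hb]
    infer_instance

theorem finrank_formsPiece (hπ : Function.Surjective π) (hk : 0 < k) (hb : IsWedgeBasis.{u} b)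
    (d : ℕ) : Module.finrank K (formsPiece (imagePiece π) k (d + k)) =
      relDim b (RingHom.ker π) d := by
  rw [formsPiece_add hk hb]
  refine finrank_map_eq_of_ker_eq _ _ ?_ _
  ext v
  rw [LinearMap.mem_ker, LinearMap.comp_apply, coordMapK_apply, LinearMap.restrictScalars_apply,
    toForms_coordMap_eq_zero_iff hπ hb, LinearMap.mem_ker, LinearMap.restrictScalars_apply,
    Submodule.mkQ_apply, Submodule.Quotient.mk_eq_zero]

/-- An alternating map on a free module is determined by its values on injective families of basis
vectors. Each such family is a reordering of some `b l`, and reordering changes both sides by the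
same sign. -/
theorem IsWedgeBasis.of_comp_perm
    (h₁ : ∀ {R : Type u} [CommRing R] (l : ι),
      minors R b (fun i => Pi.single (b l i) 1) = Pi.single l 1)
    (h₂ : ∀ c : Fin k → σ, Function.Injective c → ∃ l, ∃ τ : Equiv.Perm (Fin k), c = b l ∘ τ) :
    IsWedgeBasis.{u} b where
  minors_single := h₁
  eq_sum {R} _ {A} _ _ h v := by
    let g := (Fintype.linearCombination R
      fun l => h (fun i => Pi.single (b l i) 1)).compAlternatingMap (minors R b)
    suffices h = g from DFunLike.congr_fun this v
    refine Module.Basis.ext_alternating (Pi.basisFun R σ) fun c hc => ?_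
    obtain ⟨l, τ, rfl⟩ := h₂ c hc
    simp only [Pi.basisFun_apply]
    have e₁ := h.map_perm (fun i => Pi.single (b l i) 1) τ
    have e₂ := g.map_perm (fun i => Pi.single (b l i) 1) τ
    refine e₁.trans (Eq.trans ?_ e₂.symm)
    congr 1
    simp only [g, LinearMap.compAlternatingMap_apply, h₁,
      Fintype.linearCombination_apply_single, one_smul]

/-- The column families of the `1 × 1` minors. -/
def wedgeOne (σ : Type) : σ → Fin 1 → σ := fun l _ => l

theorem isWedgeBasis_wedgeOne : IsWedgeBasis.{u} (wedgeOne σ) := by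
  refine .of_comp_perm (fun l => ?_) fun c _ => ⟨c 0, 1, ?_⟩
  · ext j
    simp [minors_apply, wedgeOne, Pi.single_apply, eq_comm]
  · ext1 i
    simp [wedgeOne, Subsingleton.elim i 0]

/-- Ω itself is not literally its first exterior power, so the kernels are compared through
`exteriorPower.oneEquiv`. -/
theorem finrank_kaehlerPiece (hπ : Function.Surjective π) (d : ℕ) :
    Module.finrank K (kaehlerPiece (imagePiece π) (d + 1)) =
      relDim (wedgeOne σ) (RingHom.ker π) d := by
  rw [kaehlerPiece_succ]
  refine finrank_map_eq_of_ker_eq _ _ ?_ _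
  ext v
  have hf : ∀ w, exteriorPower.oneEquiv _ _ (toForms π (wedgeOne σ) w) = toKaehler π w := by
    intro w
    rw [toForms_apply, map_sum, toKaehler_apply]
    refine Finset.sum_congr rfl fun l _ => ?_
    rw [map_smul, exteriorPower.oneEquiv_ιMulti]
    rfl
  rw [LinearMap.mem_ker, LinearMap.comp_apply, coordMapK_apply, LinearMap.restrictScalars_apply,
    ← hf, LinearEquiv.map_eq_zero_iff,
    toForms_coordMap_eq_zero_iff hπ isWedgeBasis_wedgeOne, LinearMap.mem_ker,
    LinearMap.restrictScalars_apply, Submodule.mkQ_apply, Submodule.Quotient.mk_eq_zero]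

end Pieces

/-! ### Additivity over the points in large degrees -/

section Gluing

attribute [local instance] MvPolynomial.gradedAlgebra

variable {K : Type*} [Field K] {σ : Type*}

theorem pderiv_mem_pow {I : Ideal (MvPolynomial σ K)} (x : σ) (m : ℕ) {f : MvPolynomial σ K}
    (hf : f ∈ I ^ (m + 1)) : pderiv x f ∈ I ^ m := by
  induction m generalizing f with
  | zero => simp
  | succ m ih =>
    rw [pow_succ'] at hf
    induction hf using Submodule.mul_induction_on' with
    | mem_mul_mem a ha g hg =>
      rw [pderiv_mul]
      refine add_mem (Ideal.mul_mem_left _ _ hg) ?_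
      rw [pow_succ']
      exact Ideal.mul_mem_mul ha (ih hg)
    | add a _ c _ ha hc =>
      rw [map_add]
      exact add_mem ha hc

theorem relMod_mono {ι : Type*} {k : ℕ} (b : ι → Fin k → σ) {I J : Ideal (MvPolynomial σ K)}
    (h : I ≤ J) : relMod b I ≤ relMod b J :=
  relMod_le (fun _ hv => mem_relMod_of_forall_mem fun l => h (hv l))
    fun _ _ _ hf hv => minors_mem_relMod (h hf) hv

/-- In e df = d(ef) - f de, the first term is a differential of an element of `I` and the second has
entries in `I`. -/
theorem smul_mem_relMod {ι : Type*} {k : ℕ} (b : ι → Fin k → σ) {I J : Ideal (MvPolynomial σ K)}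
    {e : MvPolynomial σ K} (h1 : ∀ f ∈ J, e * f ∈ I) (h2 : ∀ f ∈ J, ∀ x, f * pderiv x e ∈ I)
    {v : ι → MvPolynomial σ K} (hv : v ∈ relMod b J) : e • v ∈ relMod b I := by
  have : relMod b J ≤ (relMod b I).comap (LinearMap.lsmul _ _ e) := by
    refine relMod_le (fun v hv => mem_relMod_of_forall_mem fun l => h1 _ (hv l))
      fun v i f hf hv => ?_
    rw [Submodule.mem_comap, LinearMap.lsmul_apply, ← Function.update_eq_self i v, hv,
      ← AlternatingMap.map_update_smul,
      show e • grad f = grad (e * f) - f • grad e by rw [grad_mul, add_sub_cancel_right],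
      AlternatingMap.map_update_sub]
    refine sub_mem (minors_mem_relMod (i := i) (h1 f hf) (by simp)) ?_
    refine mem_relMod_of_forall_mem fun l => minors_apply_mem b (i := i) (fun x => ?_) l
    simpa [grad] using h2 f hf x
  exact this hv

/-- Take any expression of `f` and keep only the degree `d` parts of the coefficients; the error
stays in `I` because `I` is homogeneous. -/
theorem exists_homogeneous_sub_mem {κ : Type*} [Fintype κ] {I : Ideal (MvPolynomial σ K)}
    (hI : I.IsHomogeneous (homogeneousSubmodule σ K)) {e : κ → MvPolynomial σ K} {D : ℕ}
    (he : ∀ j, (e j).IsHomogeneous D) {f : MvPolynomial σ K} {d : ℕ}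
    (hf : f.IsHomogeneous (d + D)) (hmem : f ∈ I ⊔ Ideal.span (Set.range e)) :
    ∃ a : κ → MvPolynomial σ K, (∀ j, (a j).IsHomogeneous d) ∧ f - ∑ j, a j * e j ∈ I := by
  obtain ⟨g, hg, h, hh, rfl⟩ := Submodule.mem_sup.1 hmem
  obtain ⟨c, rfl⟩ := Ideal.mem_span_range_iff_exists_fun.1 hh
  refine ⟨fun j => homogeneousComponent d (c j), fun j => homogeneousComponent_isHomogeneous _ _,
    ?_⟩
  have hc : ∀ j, homogeneousComponent (d + D) (c j * e j) = homogeneousComponent d (c j) * e j := by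
    intro j
    have := DirectSum.coe_decompose_mul_add_of_right_mem (homogeneousSubmodule σ K)
      (a := c j) (b := e j) (i := d) (j := D) (he j)
    rw [← decomposition.decompose'_apply, ← decomposition.decompose'_apply]
    exact this
  rw [← homogeneousComponent_eq_self hf, map_add, map_sum]
  simp only [hc, add_sub_cancel_right]
  exact homogeneousComponent_mem_of_mem hI hg _

/-- Allows powers of the irrelevant ideal contained in the single `I j ⊔ J` to be multiplied into a
power contained in the intersection plus `J`. -/
theorem prod_sup_le {A κ : Type*} [CommRing A] (I : κ → Ideal A) (J : Ideal A) (s : Finset κ) :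
    ∏ j ∈ s, (I j ⊔ J) ≤ (⨅ j ∈ s, I j) ⊔ J := by
  classical
  induction s using Finset.induction_on with
  | empty => simp
  | insert i s hi ih =>
    rw [Finset.prod_insert hi, Finset.iInf_insert]
    refine (Ideal.mul_mono le_rfl ih).trans ?_
    generalize (⨅ j ∈ s, I j) = Y
    rw [Ideal.sup_mul, Ideal.mul_sup]
    have h1 : I i * Y ≤ I i ⊓ Y := Ideal.mul_le_inf
    have h2 : I i * J ≤ J := Ideal.mul_le_right
    have h3 : J * (Y ⊔ J) ≤ J := Ideal.mul_le_left
    exact sup_le (sup_le (h1.trans le_sup_left) (h2.trans le_sup_right)) (h3.trans le_sup_right)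

theorem mem_pow_idealOfVars_of_isHomogeneous {f : MvPolynomial σ K} {n d : ℕ}
    (hf : f.IsHomogeneous d) (h : n ≤ d) : f ∈ idealOfVars σ K ^ n := by
  rw [mem_pow_idealOfVars_iff]
  intro x hx
  rw [hf.degree_eq_sum_deg_support hx] at h
  exact h

/-- The piece of degree `d` of the quotient by `relMod b I`. -/
def relPiece {ι : Type*} {k : ℕ} (b : ι → Fin k → σ) (I : Ideal (MvPolynomial σ K)) (d : ℕ) :
    Submodule K ((ι → MvPolynomial σ K) ⧸ relMod b I) :=
  (homVec K σ ι d).map ((relMod b I).mkQ.restrictScalars K)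

instance {ι : Type*} [Finite σ] [Finite ι] {k : ℕ} (b : ι → Fin k → σ)
    (I : Ideal (MvPolynomial σ K)) (d : ℕ) : FiniteDimensional K (relPiece b I d) := by
  unfold relPiece
  infer_instance

theorem finrank_relPiece {ι : Type*} {k : ℕ} (b : ι → Fin k → σ) (I : Ideal (MvPolynomial σ K))
    (d : ℕ) : Module.finrank K (relPiece b I d) = relDim b I d := rfl

/-- If all polynomials of large degree lie in `I + (e)`, and the pieces have the same dimension,
then multiplication by `e` is injective on pieces. -/
theorem eq_zero_of_smul_eq_zero {ι : Type*} [Finite σ] [Finite ι] {k : ℕ} (b : ι → Fin k → σ)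
    {I : Ideal (MvPolynomial σ K)} (hI : I.IsHomogeneous (homogeneousSubmodule σ K))
    {e : MvPolynomial σ K} {D : ℕ} (he : e.IsHomogeneous D) {n : ℕ}
    (hn : idealOfVars σ K ^ n ≤ I ⊔ Ideal.span {e}) {d : ℕ} (hd : n ≤ d + D)
    (hdim : relDim b I d = relDim b I (d + D)) {w : (ι → MvPolynomial σ K) ⧸ relMod b I}
    (hw : w ∈ relPiece b I d) (h0 : e • w = 0) : w = 0 := by
  have hmaps : ∀ w ∈ relPiece b I d,
      (LinearMap.lsmul (MvPolynomial σ K) _ e).restrictScalars K w ∈ relPiece b I (d + D) := by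
    rintro _ ⟨v, hv, rfl⟩
    refine ⟨e • v, mem_homVec.2 fun l => ?_, by simp⟩
    rw [add_comm]
    exact he.mul (mem_homVec.1 hv l)
  let μ := ((LinearMap.lsmul (MvPolynomial σ K) _ e).restrictScalars K).restrict hmaps
  have hsurj : Function.Surjective μ := by
    rintro ⟨_, v, hv, rfl⟩
    have hex : ∀ l, ∃ a : MvPolynomial σ K, a.IsHomogeneous d ∧ v l - a * e ∈ I := by
      intro l
      obtain ⟨a, ha, ha'⟩ := exists_homogeneous_sub_mem hI (e := fun _ : Unit => e) (fun _ => he)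
        (mem_homVec.1 hv l)
        (by rw [Set.range_const]
            exact hn (mem_pow_idealOfVars_of_isHomogeneous (mem_homVec.1 hv l) hd))
      exact ⟨a (), ha (), by simpa using ha'⟩
    choose a ha ha' using hex
    refine ⟨⟨_, a, mem_homVec.2 ha, rfl⟩, Subtype.ext ?_⟩
    change e • (relMod b I).mkQ a = (relMod b I).mkQ v
    rw [← map_smul, ← sub_eq_zero, ← map_sub, Submodule.mkQ_apply, Submodule.Quotient.mk_eq_zero]
    refine mem_relMod_of_forall_mem fun l => ?_
    have := I.neg_mem (ha' l)
    simpa [mul_comm] using this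
  have hdim' : Module.finrank K (relPiece b I d) = Module.finrank K (relPiece b I (d + D)) := hdim
  have hinj : Function.Injective μ := (LinearMap.injective_iff_surjective_of_finrank_eq_finrank hdim').2 hsurj
  have := @hinj ⟨w, hw⟩ 0 (Subtype.ext (by rw [map_zero]; exact h0))
  exact congrArg Subtype.val this

/-- The sum `Φ` of the multiplications by `e j` maps the local pieces of degree d bijectively to the
global piece of degree d + D. Projecting to the i-th module leaves only multiplication by `e i`,
which is injective there; surjectivity holds because forms of large degree lie in `J` plus the ideal
of all `e j`. -/
theorem relDim_iInf {ι : Type*} [Finite σ] [Finite ι] {k : ℕ} (b : ι → Fin k → σ)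
    {κ : Type*} [Fintype κ] [DecidableEq κ] (I : κ → Ideal (MvPolynomial σ K))
    (hI : ∀ j, (I j).IsHomogeneous (homogeneousSubmodule σ K)) (e : κ → MvPolynomial σ K) {D : ℕ}
    (he : ∀ j, (e j).IsHomogeneous D) (hmem : ∀ i j, i ≠ j → e j ∈ I i)
    (hder : ∀ i j, i ≠ j → ∀ x, pderiv x (e j) ∈ I i) (n : κ → ℕ)
    (hn : ∀ j, idealOfVars σ K ^ n j ≤ I j ⊔ Ideal.span {e j}) (c : κ → ℕ) (N : ℕ)
    (hc : ∀ j, ∀ d ≥ N, relDim b (I j) d = c j) :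
    ∃ N' : ℕ, ∀ d ≥ N', relDim b (⨅ j, I j) d = ∑ j, c j := by
  set J := ⨅ j, I j with hJ
  have hJhom : J.IsHomogeneous (homogeneousSubmodule σ K) := Ideal.IsHomogeneous.iInf hI
  have hn' : idealOfVars σ K ^ (∑ j, n j) ≤ J ⊔ Ideal.span (Set.range e) := by
    rw [← Finset.prod_pow_eq_pow_sum]
    have h := prod_sup_le I (Ideal.span (Set.range e)) Finset.univ
    simp only [Finset.mem_univ, iInf_pos] at h
    refine le_trans (Finset.prod_le_prod' fun j _ => (hn j).trans ?_) h
    exact sup_le_sup_left (Ideal.span_mono (by simp)) _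
  have hle : ∀ j, J ≤ I j := fun j => iInf_le I j
  have hμ : ∀ j, relMod b (I j) ≤ (relMod b J).comap (LinearMap.lsmul _ _ (e j)) := by
    intro j v hv
    refine smul_mem_relMod b (J := I j) (fun f hf => ?_) (fun f hf x => ?_) hv
    · refine Ideal.mem_iInf.2 fun i => ?_
      by_cases h : i = j
      · subst h; exact Ideal.mul_mem_left _ _ hf
      · exact Ideal.mul_mem_right _ _ (hmem i j h)
    · refine Ideal.mem_iInf.2 fun i => ?_
      by_cases h : i = j
      · subst h; exact Ideal.mul_mem_right _ _ hf
      · exact Ideal.mul_mem_left _ _ (hder i j h x)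
  let μ := fun j => (relMod b (I j)).mapQ (relMod b J) (LinearMap.lsmul _ _ (e j)) (hμ j)
  let p := fun j => (relMod b J).mapQ (relMod b (I j)) LinearMap.id
    (by rw [Submodule.comap_id]; exact relMod_mono b (hle j))
  have hpμ : ∀ i j w, i ≠ j → p i (μ j w) = 0 := by
    intro i j w hij
    obtain ⟨v, rfl⟩ := Submodule.mkQ_surjective _ w
    change (relMod b (I i)).mkQ (e j • v) = 0
    rw [Submodule.mkQ_apply, Submodule.Quotient.mk_eq_zero]
    exact mem_relMod_of_forall_mem fun l => Ideal.mul_mem_right _ _ (hmem i j hij)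
  have hpμ' : ∀ j w, p j (μ j w) = e j • w := by
    intro j w
    obtain ⟨v, rfl⟩ := Submodule.mkQ_surjective _ w
    change (relMod b (I j)).mkQ (e j • v) = e j • (relMod b (I j)).mkQ v
    rw [map_smul]
  refine ⟨N + (∑ j, n j) + D, fun d' hd' => ?_⟩
  obtain ⟨d, rfl⟩ : ∃ d, d' = d + D := ⟨d' - D, by omega⟩
  let Φ : (∀ j, relPiece b (I j) d) →ₗ[K] ((ι → MvPolynomial σ K) ⧸ relMod b J) :=
    ∑ j, (μ j).restrictScalars K ∘ₗ (relPiece b (I j) d).subtype ∘ₗ LinearMap.proj j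
  have hΦ : ∀ w, Φ w = ∑ j, μ j (w j) := fun w => by simp [Φ]
  have hinj : Function.Injective Φ := by
    intro w w' hw
    have hp : ∀ w i, p i (Φ w) = e i • ((w i : _) : (ι → MvPolynomial σ K) ⧸ relMod b (I i)) := by
      intro w i
      rw [hΦ, map_sum, Finset.sum_eq_single i (fun j _ hj => hpμ i j _ hj.symm) (by simp), hpμ']
    ext1 i
    have h0 : e i • ((w i : (ι → MvPolynomial σ K) ⧸ relMod b (I i)) - w' i) = 0 := by
      rw [smul_sub, ← hp, ← hp, hw, sub_self]
    have hni : n i ≤ ∑ j, n j := Finset.single_le_sum (fun _ _ => Nat.zero_le _)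
      (Finset.mem_univ i)
    exact Subtype.ext (sub_eq_zero.1 (eq_zero_of_smul_eq_zero b (hI i) (he i) (hn i) (by omega)
      (by rw [hc i d (by omega), hc i (d + D) (by omega)])
      (Submodule.sub_mem _ (w i).2 (w' i).2) h0))
  have hrange : LinearMap.range Φ = relPiece b J (d + D) := by
    apply le_antisymm
    · rintro _ ⟨w, rfl⟩
      rw [hΦ]
      refine Submodule.sum_mem _ fun j _ => ?_
      obtain ⟨v, hv, hvw⟩ := (w j).2
      refine ⟨e j • v, mem_homVec.2 fun l => ?_, ?_⟩
      · rw [add_comm]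
        exact (he j).mul (mem_homVec.1 hv l)
      · rw [← hvw]
        rfl
    · rintro _ ⟨v, hv, rfl⟩
      choose a ha ha' using fun l => exists_homogeneous_sub_mem hJhom he (mem_homVec.1 hv l)
        (hn' (mem_pow_idealOfVars_of_isHomogeneous (mem_homVec.1 hv l) (by omega)))
      refine ⟨fun j => ⟨(relMod b (I j)).mkQ fun l => a l j,
        ⟨_, mem_homVec.2 fun l => ha l j, rfl⟩⟩, ?_⟩
      rw [hΦ]
      change ∑ j, (relMod b J).mkQ (e j • fun l => a l j) = (relMod b J).mkQ v
      rw [← map_sum, ← sub_eq_zero, ← map_sub, Submodule.mkQ_apply,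
        Submodule.Quotient.mk_eq_zero]
      refine mem_relMod_of_forall_mem fun l => ?_
      have := J.neg_mem (ha' l)
      simpa [mul_comm] using this
  have hfree : ∀ j, Module.Free K (relPiece b (I j) d) := fun j => Module.Free.of_divisionRing K _
  rw [← finrank_relPiece, ← hrange, LinearMap.finrank_range_of_inj hinj,
    Module.finrank_pi_fintype]
  exact Finset.sum_congr rfl fun j _ => hc j d (by omega)

end Gluing

/-! ### Bases of the exterior powers in three variables -/

section Wedge

/-- The column families of the `2 × 2` minors of matrices with three columns. -/
def wedgeTwo : Fin 3 → Fin 2 → Fin 3 := ![![1, 2], ![0, 1], ![0, 2]]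

/-- The column family of the `3 × 3` minor of matrices with three columns. -/
def wedgeThree : Fin 1 → Fin 3 → Fin 3 := fun _ => id

theorem isWedgeBasis_wedgeTwo : IsWedgeBasis.{u} wedgeTwo := by
  refine .of_comp_perm (fun l => ?_) (by decide)
  ext j
  rw [minors_apply, Matrix.det_fin_two]
  simp only [Matrix.of_apply, Pi.single_apply]
  fin_cases l <;> fin_cases j <;> simp [wedgeTwo]

theorem isWedgeBasis_wedgeThree : IsWedgeBasis.{u} wedgeThree := by
  refine .of_comp_perm (fun {R} _ l => ?_) fun c hc =>
    ⟨0, Equiv.ofBijective c (Finite.injective_iff_bijective.1 hc), rfl⟩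
  ext j
  have h1 : (Matrix.of fun i i' => (Pi.single (wedgeThree l i) 1 : Fin 3 → R) (wedgeThree j i')) =
      1 := by
    ext i i'
    rw [Matrix.of_apply, Matrix.one_apply, Pi.single_apply]
    exact if_congr eq_comm rfl rfl
  rw [minors_apply, h1, Matrix.det_one, Subsingleton.elim j l, Pi.single_eq_same]

end Wedge

/-! ### Relations at the point (1 : 0 : 0) -/

section Local

variable {K : Type*} [Field K]

/-- The ideal of the coordinate point `(1 : 0 : 0)`. -/
def axisIdeal (K : Type*) [Field K] : Ideal (MvPolynomial (Fin 3) K) := Ideal.span {X 1, X 2}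

theorem X_one_mem : (X 1 : MvPolynomial (Fin 3) K) ∈ axisIdeal K :=
  Ideal.subset_span (by simp)

theorem X_two_mem : (X 2 : MvPolynomial (Fin 3) K) ∈ axisIdeal K :=
  Ideal.subset_span (by simp)

theorem coeff_X_mul_eq_zero {f : MvPolynomial (Fin 3) K} {a : ℕ} {x : Fin 3} (hx : x = 1 ∨ x = 2)
    (hf : ∀ α : Fin 3 →₀ ℕ, α 1 + α 2 < a → coeff α f = 0) (α : Fin 3 →₀ ℕ)
    (hα : α 1 + α 2 < a + 1) : coeff α (X x * f) = 0 := by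
  classical
  rw [coeff_X_mul']
  split_ifs with h
  · apply hf
    rw [Finsupp.mem_support_iff] at h
    rcases hx with rfl | rfl
    · simp; omega
    · simp; omega
  · rfl

/-- The ideal is monomial, so order of vanishing is read off monomial by monomial. -/
theorem mem_axisIdeal_pow {a : ℕ} {f : MvPolynomial (Fin 3) K} :
    f ∈ axisIdeal K ^ a ↔ ∀ α : Fin 3 →₀ ℕ, α 1 + α 2 < a → coeff α f = 0 := by
  constructor
  · intro hf
    induction a generalizing f with
    | zero => simp
    | succ a ih =>
      rw [pow_succ'] at hf
      induction hf using Submodule.mul_induction_on' with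
      | mem_mul_mem q hq g hg =>
        obtain ⟨u, w, rfl⟩ := Ideal.mem_span_pair.1 hq
        intro α hα
        rw [show (u * X 1 + w * X 2) * g = X 1 * (u * g) + X 2 * (w * g) by ring, coeff_add,
          coeff_X_mul_eq_zero (.inl rfl) (ih (Ideal.mul_mem_left _ u hg)) α hα,
          coeff_X_mul_eq_zero (.inr rfl) (ih (Ideal.mul_mem_left _ w hg)) α hα, add_zero]
      | add p _ q _ hp hq =>
        intro α hα
        rw [coeff_add, hp α hα, hq α hα, add_zero]
  · intro hf
    rw [f.as_sum]
    refine Submodule.sum_mem _ fun α hα => ?_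
    have hle : a ≤ α 1 + α 2 := by
      by_contra h
      exact mem_support_iff.1 hα (hf α (by omega))
    rw [monomial_eq, Finsupp.prod_fintype _ _ (by simp), Fin.prod_univ_three]
    refine Ideal.mul_mem_left _ _ ?_
    rw [mul_assoc]
    refine Ideal.mul_mem_left _ _ (Ideal.pow_le_pow_right hle ?_)
    rw [pow_add]
    exact Ideal.mul_mem_mul (Ideal.pow_mem_pow X_one_mem _) (Ideal.pow_mem_pow X_two_mem _)

theorem coeff_X_mul_pderiv (f : MvPolynomial (Fin 3) K) (x : Fin 3) (α : Fin 3 →₀ ℕ) :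
    coeff α (X x * pderiv x f) = α x * coeff α f := by
  classical
  rw [coeff_X_mul']
  split_ifs with h
  · rw [Finsupp.mem_support_iff] at h
    have hle : Finsupp.single x 1 ≤ α := by
      rw [Finsupp.single_le_iff]
      omega
    rw [coeff_pderiv, tsub_add_cancel_of_le hle]
    have : (α - Finsupp.single x 1 : Fin 3 →₀ ℕ) x + 1 = α x := by simp; omega
    rw [mul_comm, ← this]
    push_cast
    rfl
  · rw [Finsupp.notMem_support_iff] at h
    simp [h]

/-- The operator X_1 ∂_1 + X_2 ∂_2 multiplies a monomial by its degree in X_1, X_2, so subtracting a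
· f cancels the part of degree exactly a. -/
theorem euler_mem {a : ℕ} {f : MvPolynomial (Fin 3) K} (hf : f ∈ axisIdeal K ^ a) :
    X 1 * pderiv 1 f + X 2 * pderiv 2 f - (a : MvPolynomial (Fin 3) K) * f ∈
      axisIdeal K ^ (a + 1) := by
  rw [mem_axisIdeal_pow] at hf ⊢
  intro α hα
  rw [coeff_sub, coeff_add, coeff_X_mul_pderiv, coeff_X_mul_pderiv,
    show (a : MvPolynomial (Fin 3) K) = C (a : K) by simp, coeff_C_mul]
  rcases Nat.lt_succ_iff_lt_or_eq.1 hα with h | h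
  · simp [hf α h]
  · rw [← h]
    push_cast
    ring

/-- Vectors whose first entry vanishes to order `c` at the point `(1 : 0 : 0)`, and whose other
entries vanish to order `a` and form a closed differential up to terms of order `a`. -/
def closedMod (K : Type*) [Field K] (a c : ℕ) :
    Submodule (MvPolynomial (Fin 3) K) (Fin 3 → MvPolynomial (Fin 3) K) where
  carrier := {v | v 0 ∈ axisIdeal K ^ c ∧ v 1 ∈ axisIdeal K ^ a ∧ v 2 ∈ axisIdeal K ^ a ∧
    pderiv 2 (v 1) - pderiv 1 (v 2) ∈ axisIdeal K ^ a}
  add_mem' := by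
    rintro v w ⟨h0, h1, h2, h3⟩ ⟨g0, g1, g2, g3⟩
    refine ⟨add_mem h0 g0, add_mem h1 g1, add_mem h2 g2, ?_⟩
    have := add_mem h3 g3
    rw [Pi.add_apply, Pi.add_apply, map_add, map_add]
    convert this using 1
    ring
  zero_mem' := by simp
  smul_mem' := by
    rintro f v ⟨h0, h1, h2, h3⟩
    refine ⟨Ideal.mul_mem_left _ _ h0, Ideal.mul_mem_left _ _ h1, Ideal.mul_mem_left _ _ h2, ?_⟩
    -- By the Leibniz rule the extra terms are multiples of `v 1` and `v 2`, which have order `a`.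
    have := add_mem (Ideal.mul_mem_left _ f h3) (sub_mem (Ideal.mul_mem_left _ (pderiv 2 f) h1)
      (Ideal.mul_mem_left _ (pderiv 1 f) h2))
    rw [Pi.smul_apply, Pi.smul_apply, smul_eq_mul, smul_eq_mul, pderiv_mul, pderiv_mul]
    convert this using 1
    ring

theorem mem_closedMod {a c : ℕ} {v : Fin 3 → MvPolynomial (Fin 3) K} :
    v ∈ closedMod K a c ↔ v 0 ∈ axisIdeal K ^ c ∧ v 1 ∈ axisIdeal K ^ a ∧ v 2 ∈ axisIdeal K ^ a ∧
      pderiv 2 (v 1) - pderiv 1 (v 2) ∈ axisIdeal K ^ a := Iff.rfl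

theorem pderiv_zero_mem {a : ℕ} {f : MvPolynomial (Fin 3) K} (hf : f ∈ axisIdeal K ^ a) :
    pderiv 0 f ∈ axisIdeal K ^ a := by
  rw [mem_axisIdeal_pow] at hf ⊢
  intro α hα
  rw [coeff_pderiv, hf _ (by simpa using hα), zero_mul]

theorem pderiv_comm (x y : Fin 3) (f : MvPolynomial (Fin 3) K) :
    pderiv x (pderiv y f) = pderiv y (pderiv x f) := by
  ext α
  simp only [coeff_pderiv]
  by_cases h : x = y
  · rw [h]
  · rw [add_right_comm]
    simp [h, Ne.symm h]
    ring

theorem mem_closedMod_of_forall_mem {a c : ℕ} (hc : c ≤ a + 1)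
    {v : Fin 3 → MvPolynomial (Fin 3) K} (hv : ∀ l, v l ∈ axisIdeal K ^ (a + 1)) :
    v ∈ closedMod K a c :=
  ⟨Ideal.pow_le_pow_right hc (hv 0), Ideal.pow_le_pow_right a.le_succ (hv 1),
    Ideal.pow_le_pow_right a.le_succ (hv 2), sub_mem (pderiv_mem_pow _ _ (hv 1))
    (pderiv_mem_pow _ _ (hv 2))⟩

theorem grad_mem_closedMod {a : ℕ} {f : MvPolynomial (Fin 3) K}
    (hf : f ∈ axisIdeal K ^ (a + 1)) : grad f ∈ closedMod K a (a + 1) :=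
  ⟨pderiv_zero_mem hf, pderiv_mem_pow _ _ hf, pderiv_mem_pow _ _ hf, by
    simp [grad, pderiv_comm 2 1 f]⟩

/-- A closed vector of order `a` is a gradient up to terms of higher order. -/
theorem exists_grad_sub_mem {a c : ℕ} {v : Fin 3 → MvPolynomial (Fin 3) K}
    (hv : v ∈ closedMod K a c) : ∃ f ∈ axisIdeal K ^ (a + 1), ∀ l, l ≠ 0 →
      ((a + 1 : ℕ) : MvPolynomial (Fin 3) K) * v l - grad f l ∈ axisIdeal K ^ (a + 1) := by
  obtain ⟨-, h1, h2, h3⟩ := hv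
  -- The homotopy of the Poincaré lemma: ∂_1 f is (a+1) v_1 plus the Euler error of v_1 minus X_2
  -- (∂_2 v_1 - ∂_1 v_2), and symmetrically for ∂_2 f.
  refine ⟨X 1 * v 1 + X 2 * v 2, ?_, ?_⟩
  · rw [pow_succ']
    exact add_mem (Ideal.mul_mem_mul X_one_mem h1) (Ideal.mul_mem_mul X_two_mem h2)
  · intro l hl
    have e1 := euler_mem h1
    have e2 := euler_mem h2
    have k1 : X 2 * (pderiv 2 (v 1) - pderiv 1 (v 2)) ∈ axisIdeal K ^ (a + 1) := by
      rw [pow_succ']; exact Ideal.mul_mem_mul X_two_mem h3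
    have k2 : X 1 * (pderiv 2 (v 1) - pderiv 1 (v 2)) ∈ axisIdeal K ^ (a + 1) := by
      rw [pow_succ']; exact Ideal.mul_mem_mul X_one_mem h3
    fin_cases l
    · exact absurd rfl hl
    · have := sub_mem k1 e1
      convert this using 1
      simp [grad, pderiv_X]
      ring
    · have := neg_mem (add_mem k2 e2)
      convert this using 1
      simp [grad, pderiv_X]
      ring

theorem minors_wedgeOne {R : Type*} [CommRing R] (v : Fin 1 → Fin 3 → R) :
    minors R (wedgeOne (Fin 3)) v = v 0 := by
  ext l
  simp [minors_apply, wedgeOne]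

theorem minors_wedgeTwo {R : Type*} [CommRing R] (v : Fin 2 → Fin 3 → R) :
    minors R wedgeTwo v = ![v 0 1 * v 1 2 - v 0 2 * v 1 1, v 0 0 * v 1 1 - v 0 1 * v 1 0,
      v 0 0 * v 1 2 - v 0 2 * v 1 0] := by
  ext l
  fin_cases l <;> simp [minors_apply, wedgeTwo, Matrix.det_fin_two]

theorem mem_of_natCast_mul_mem [CharZero K] {ι : Type*}
    {N : Submodule (MvPolynomial (Fin 3) K) (ι → MvPolynomial (Fin 3) K)} {n : ℕ}
    {v : ι → MvPolynomial (Fin 3) K}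
    (h : ((n + 1 : ℕ) : MvPolynomial (Fin 3) K) • v ∈ N) : v ∈ N := by
  have := N.smul_mem (C ((n + 1 : ℕ) : K)⁻¹) h
  rwa [smul_smul, show ((n + 1 : ℕ) : MvPolynomial (Fin 3) K) = C ((n + 1 : ℕ) : K) by simp,
    ← C_mul, inv_mul_cancel₀ (Nat.cast_ne_zero.2 n.succ_ne_zero), C_1, one_smul] at this

theorem relMod_wedgeOne [CharZero K] (a : ℕ) :
    relMod (wedgeOne (Fin 3)) (axisIdeal K ^ (a + 1)) = closedMod K a (a + 1) := by
  apply le_antisymm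
  · refine relMod_le (fun v hv => mem_closedMod_of_forall_mem le_rfl hv) fun v i f hf hv => ?_
    rw [minors_wedgeOne, ← Subsingleton.elim i 0, hv]
    exact grad_mem_closedMod hf
  · intro v hv
    obtain ⟨f, hf, hfv⟩ := exists_grad_sub_mem hv
    apply mem_of_natCast_mul_mem (n := a)
    rw [← sub_add_cancel (((a + 1 : ℕ) : MvPolynomial (Fin 3) K) • v) (grad f)]
    refine add_mem (mem_relMod_of_forall_mem fun l => ?_) ?_
    · by_cases hl : l = 0
      · subst hl
        exact sub_mem (Ideal.mul_mem_left _ _ hv.1) (pderiv_zero_mem hf)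
      · exact hfv l hl
    · have := minors_mem_relMod (b := wedgeOne (Fin 3)) (v := fun _ => grad f) (i := 0) hf rfl
      rwa [minors_wedgeOne] at this

/-- Up to an Euler error in p^(a+1), (a+2) g equals ∂_1(X_1 g) + ∂_2(X_2 g), so single partial
derivatives of elements of p^(a+1) suffice to reach all of p^a. -/
theorem mem_relMod_of_single_zero [CharZero K] {ι : Type*} [DecidableEq ι] {k : ℕ}
    {b : ι → Fin k → Fin 3} {a : ℕ} {l : ι} {g : MvPolynomial (Fin 3) K}
    (hg : g ∈ axisIdeal K ^ a)
    (h1 : ∀ f ∈ axisIdeal K ^ (a + 1),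
      Pi.single l (pderiv 1 f) ∈ relMod b (axisIdeal K ^ (a + 1)))
    (h2 : ∀ f ∈ axisIdeal K ^ (a + 1),
      Pi.single l (pderiv 2 f) ∈ relMod b (axisIdeal K ^ (a + 1))) :
    Pi.single l g ∈ relMod b (axisIdeal K ^ (a + 1)) := by
  have e := euler_mem hg
  have m1 : X 1 * g ∈ axisIdeal K ^ (a + 1) := by
    rw [pow_succ']; exact Ideal.mul_mem_mul X_one_mem hg
  have m2 : X 2 * g ∈ axisIdeal K ^ (a + 1) := by
    rw [pow_succ']; exact Ideal.mul_mem_mul X_two_mem hg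
  apply mem_of_natCast_mul_mem (n := a + 1)
  have e' : (Pi.single l (X 1 * pderiv 1 g + X 2 * pderiv 2 g -
      (a : MvPolynomial (Fin 3) K) * g) : ι → _) ∈ relMod b (axisIdeal K ^ (a + 1)) := by
    refine mem_relMod_of_forall_mem fun j => ?_
    by_cases h : j = l
    · subst h; simpa using e
    · simp [h]
  have := sub_mem (add_mem (h1 _ m1) (h2 _ m2)) e'
  rw [← Pi.single_add, ← Pi.single_sub] at this
  have heq : ((a + 1 + 1 : ℕ) : MvPolynomial (Fin 3) K) * g = pderiv 1 (X 1 * g) +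
      pderiv 2 (X 2 * g) - (X 1 * pderiv 1 g + X 2 * pderiv 2 g -
        (a : MvPolynomial (Fin 3) K) * g) := by
    rw [pderiv_mul, pderiv_mul, pderiv_X_self, pderiv_X_self]
    push_cast
    ring
  rw [← Pi.single_smul, smul_eq_mul, heq]
  exact this

/-- The order in `wedgeTwo` puts dX_1 ∧ dX_2 at entry 0 and dX_0 ∧ dX_1, dX_0 ∧ dX_2 at entries 1
and 2. Products dX_0 ∧ df produce the closed pairs in the last two entries, and products of df with
dX_1 or dX_2 produce order `a` in entry 0. -/
theorem relMod_wedgeTwo [CharZero K] (a : ℕ) :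
    relMod wedgeTwo (axisIdeal K ^ (a + 1)) = closedMod K a a := by
  apply le_antisymm
  · have key : ∀ (f : MvPolynomial (Fin 3) K) (u : Fin 3 → MvPolynomial (Fin 3) K),
        f ∈ axisIdeal K ^ (a + 1) → minors _ wedgeTwo ![grad f, u] ∈ closedMod K a a := by
      intro f u hf
      have f0 := pderiv_zero_mem hf
      have f1 := pderiv_mem_pow 1 a hf
      have f2 := pderiv_mem_pow 2 a hf
      have f0' : pderiv 0 f ∈ axisIdeal K ^ a := Ideal.pow_le_pow_right a.le_succ f0
      have f01 := pderiv_mem_pow 1 a f0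
      have f02 := pderiv_mem_pow 2 a f0
      rw [minors_wedgeTwo]
      refine ⟨?_, ?_, ?_, ?_⟩
      · exact sub_mem (Ideal.mul_mem_right _ _ f1) (Ideal.mul_mem_right _ _ f2)
      · exact sub_mem (Ideal.mul_mem_right _ _ f0') (Ideal.mul_mem_right _ _ f1)
      · exact sub_mem (Ideal.mul_mem_right _ _ f0') (Ideal.mul_mem_right _ _ f2)
      -- The two terms with ∂_1 ∂_2 f cancel; every other second derivative involves ∂_0 and so has
      -- order `a`.
      · have h := add_mem (add_mem (Ideal.mul_mem_left _ (u 1) f02)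
          (Ideal.mul_mem_left _ (pderiv 2 (u 1) - pderiv 1 (u 2)) f0'))
          (sub_mem (sub_mem (Ideal.mul_mem_left _ (pderiv 1 (u 0)) f2)
          (Ideal.mul_mem_left _ (pderiv 2 (u 0)) f1)) (Ideal.mul_mem_left _ (u 2) f01))
        convert h using 1
        simp [grad, pderiv_comm 2 1 f]
        ring
    refine relMod_le (fun v hv => mem_closedMod_of_forall_mem a.le_succ hv) fun v i f hf hv => ?_
    fin_cases i
    · have := key f (v 1) hf
      convert this using 2
      ext1 j
      fin_cases j
      · exact hv
      · rfl
    · have := neg_mem (key f (v 0) hf)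
      convert this using 1
      replace hv : v 1 = grad f := hv
      rw [minors_wedgeTwo, minors_wedgeTwo]
      ext1 j
      fin_cases j <;> simp [hv] <;> ring
  · intro w hw
    have hw0 : (Pi.single 0 (w 0) : Fin 3 → _) ∈ relMod wedgeTwo (axisIdeal K ^ (a + 1)) := by
      -- The products df ∧ dX_2 and dX_1 ∧ df have ∂_1 f and ∂_2 f in entry 0; their other entries
      -- are 0 or ±∂_0 f, which lies in p^(a+1).
      refine mem_relMod_of_single_zero hw.1 (fun f hf => ?_) (fun f hf => ?_)
      · have h1 := minors_mem_relMod (b := wedgeTwo) (v := ![grad f, Pi.single 2 1]) (i := 0) hf rfl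
        rw [← sub_add_cancel (Pi.single (0 : Fin 3) (pderiv 1 f))
          (minors _ wedgeTwo ![grad f, Pi.single 2 1])]
        refine add_mem (mem_relMod_of_forall_mem fun l => ?_) h1
        rw [minors_wedgeTwo]
        have := pderiv_zero_mem hf
        fin_cases l <;> simp [grad, this]
      · have h1 := minors_mem_relMod (b := wedgeTwo) (v := ![Pi.single 1 1, grad f]) (i := 1) hf rfl
        rw [← sub_add_cancel (Pi.single (0 : Fin 3) (pderiv 2 f))
          (minors _ wedgeTwo ![Pi.single 1 1, grad f])]
        refine add_mem (mem_relMod_of_forall_mem fun l => ?_) h1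
        rw [minors_wedgeTwo]
        have := pderiv_zero_mem hf
        fin_cases l <;> simp [grad, this]
    obtain ⟨f, hf, hfw⟩ := exists_grad_sub_mem hw
    apply mem_of_natCast_mul_mem (n := a)
    have h1 := minors_mem_relMod (b := wedgeTwo) (v := ![Pi.single 0 1, grad f]) (i := 1) hf rfl
    rw [← sub_add_cancel (((a + 1 : ℕ) : MvPolynomial (Fin 3) K) • w)
      (((a + 1 : ℕ) : MvPolynomial (Fin 3) K) • (Pi.single 0 (w 0) : Fin 3 → _)
        + minors _ wedgeTwo ![Pi.single 0 1, grad f])]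
    refine add_mem (mem_relMod_of_forall_mem fun l => ?_) (add_mem (Submodule.smul_mem _ _ hw0) h1)
    rw [minors_wedgeTwo, Pi.sub_apply, Pi.add_apply, Pi.smul_apply, Pi.smul_apply]
    have := hfw l
    fin_cases l
    · simp
    · simpa using this (by decide)
    · simpa using this (by decide)

/-- Any factor df has entries in p^a. Conversely, replacing row x of the identity matrix by the
gradient of f gives determinant ∂_x f. -/
theorem mem_relMod_wedgeThree [CharZero K] {a : ℕ} {w : Fin 1 → MvPolynomial (Fin 3) K} :
    w ∈ relMod wedgeThree (axisIdeal K ^ (a + 1)) ↔ w 0 ∈ axisIdeal K ^ a := by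
  constructor
  · have : relMod wedgeThree (axisIdeal K ^ (a + 1)) ≤
        (Submodule.pi Set.univ fun _ => axisIdeal K ^ a) := by
      refine relMod_le (fun v hv l _ => Ideal.pow_le_pow_right a.le_succ (hv l))
        fun v i f hf hv l _ => ?_
      refine minors_apply_mem wedgeThree (i := i) (fun j => ?_) l
      rw [hv]
      exact pderiv_mem_pow j a hf
    exact fun hw => this hw 0 trivial
  · intro hw
    have hdet : ∀ f ∈ axisIdeal K ^ (a + 1), ∀ x, (Pi.single 0 (pderiv x f) : Fin 1 → _) ∈
        relMod wedgeThree (axisIdeal K ^ (a + 1)) := by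
      intro f hf x
      have := minors_mem_relMod (b := wedgeThree)
        (v := Function.update (fun i => Pi.single i 1) x (grad f)) (i := x) hf (by simp)
      convert this using 1
      ext1 j
      rw [Subsingleton.elim j 0, Pi.single_eq_same, minors_apply, Matrix.det_fin_three]
      fin_cases x <;> simp [wedgeThree, grad]
    have := mem_relMod_of_single_zero (b := wedgeThree) (l := 0) hw (fun f hf => hdet f hf 1)
      (fun f hf => hdet f hf 2)
    convert this using 1
    ext1 j
    rw [Subsingleton.elim j 0, Pi.single_eq_same]

end Local

/-! ### Counting coefficients at one point -/

section LocalDimension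

variable {K : Type*} [Field K]

/-- The exponent of the monomial of degree `d` with exponents `i` and `j` in the last variables. -/
def expo (d i j : ℕ) : Fin 3 →₀ ℕ := Finsupp.equivFunOnFinite.symm ![d - i - j, i, j]

@[simp] theorem expo_zero (d i j : ℕ) : expo d i j 0 = d - i - j := rfl
@[simp] theorem expo_one (d i j : ℕ) : expo d i j 1 = i := rfl
@[simp] theorem expo_two (d i j : ℕ) : expo d i j 2 = j := rfl

theorem degree_fin_three (α : Fin 3 →₀ ℕ) : α.degree = α 0 + α 1 + α 2 := by
  rw [Finsupp.degree_eq_sum, Fin.sum_univ_three]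

theorem eq_expo {α : Fin 3 →₀ ℕ} {d : ℕ} (h : α.degree = d) : α = expo d (α 1) (α 2) := by
  rw [degree_fin_three] at h
  ext x
  fin_cases x
  · simp; omega
  · simp
  · simp

/-- The homogeneous polynomial of degree `d` with prescribed coefficients. -/
def polyOf (d : ℕ) (h : ℕ → ℕ → K) : MvPolynomial (Fin 3) K :=
  ∑ i ∈ Finset.range (d + 1), ∑ j ∈ Finset.range (d + 1 - i), monomial (expo d i j) (h i j)

theorem isHomogeneous_polyOf (d : ℕ) (h : ℕ → ℕ → K) : (polyOf d h).IsHomogeneous d := by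
  refine IsHomogeneous.sum _ _ _ fun i hi => IsHomogeneous.sum _ _ _ fun j hj =>
    isHomogeneous_monomial _ ?_
  rw [Finset.mem_range] at hi hj
  rw [degree_fin_three, expo_zero, expo_one, expo_two]
  omega

theorem coeff_polyOf {d i j : ℕ} (h : ℕ → ℕ → K) (hij : i + j ≤ d) :
    coeff (expo d i j) (polyOf d h) = h i j := by
  classical
  rw [polyOf, coeff_sum, Finset.sum_eq_single i, coeff_sum, Finset.sum_eq_single j]
  · simp
  · intro j' _ hj'
    rw [coeff_monomial, if_neg]
    intro h'
    exact hj' (by simpa using DFunLike.congr_fun h' 2)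
  · intro hj
    exact absurd (Finset.mem_range.2 (by omega)) hj
  · intro i' _ hi'
    rw [coeff_sum]
    refine Finset.sum_eq_zero fun j' _ => ?_
    rw [coeff_monomial, if_neg]
    intro h'
    exact hi' (by simpa using DFunLike.congr_fun h' 1)
  · intro hi
    exact absurd (Finset.mem_range.2 (by omega)) hi

/-- Pairs of exponents `(i, t - i)` with `t < a`. -/
abbrev LowIndex (a : ℕ) : Type := Σ t : Fin a, Fin (t + 1)

theorem card_lowIndex (a : ℕ) : 2 * Fintype.card (LowIndex a) = a * (a + 1) := by
  rw [Fintype.card_sigma]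
  simp only [Fintype.card_fin]
  rw [Fin.sum_univ_eq_sum_range (fun t => t + 1) a]
  induction a with
  | zero => simp
  | succ a ih => rw [Finset.sum_range_succ, mul_add, ih]; ring

/-- The coefficients, in degree `d`, of the monomials of degree less than `a` in the last two
variables. -/
def lowCoeff (K : Type*) [Field K] (d a : ℕ) : MvPolynomial (Fin 3) K →ₗ[K] (LowIndex a → K) :=
  LinearMap.pi fun p => lcoeff K (expo d p.2 (p.1 - p.2))

theorem lowCoeff_apply (d a : ℕ) (f : MvPolynomial (Fin 3) K) (p : LowIndex a) :
    lowCoeff K d a f p = coeff (expo d p.2 (p.1 - p.2)) f := rfl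

theorem lowCoeff_eq_zero_iff {d a : ℕ} {f : MvPolynomial (Fin 3) K} (hf : f.IsHomogeneous d) :
    lowCoeff K d a f = 0 ↔ f ∈ axisIdeal K ^ a := by
  rw [mem_axisIdeal_pow]
  constructor
  · intro h α hα
    by_cases hd : α.degree = d
    · have := congrFun h ⟨⟨α 1 + α 2, hα⟩, ⟨α 1, by simp⟩⟩
      rw [lowCoeff_apply] at this
      rw [eq_expo hd]
      simpa using this
    · exact hf.coeff_eq_zero hd
  · intro h
    ext p
    rw [lowCoeff_apply, h]
    · rfl
    · have h1 := p.1.2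
      have h2 := p.2.2
      simp only [expo_one, expo_two]
      omega

/-- Extension of a family of low coefficients by zero. -/
def extendLow {a : ℕ} (β : LowIndex a → K) (i j : ℕ) : K :=
  if h : i + j < a then β ⟨⟨i + j, h⟩, ⟨i, by simp⟩⟩ else 0

theorem extendLow_apply {a : ℕ} (β : LowIndex a → K) (p : LowIndex a) :
    extendLow β p.2 (p.1 - p.2) = β p := by
  obtain ⟨⟨t, ht⟩, ⟨i, hi⟩⟩ := p
  simp only at hi
  obtain ⟨j, rfl⟩ := Nat.exists_eq_add_of_le (Nat.lt_succ_iff.1 hi)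
  simp only [Nat.add_sub_cancel_left]
  exact dif_pos ht

theorem extendLow_of_le {a i j : ℕ} (β : LowIndex a → K) (h : a ≤ i + j) :
    extendLow β i j = 0 := dif_neg (by omega)

theorem finrank_map_mkQ {V' : Type*} [AddCommGroup V'] [Module K V'] {ι : Type*} [Finite ι] {d : ℕ}
    {N : Submodule (MvPolynomial (Fin 3) K) (ι → MvPolynomial (Fin 3) K)}
    (Θ : (ι → MvPolynomial (Fin 3) K) →ₗ[K] V') (h0 : ∀ v ∈ homVec K (Fin 3) ι d, Θ v = 0 ↔ v ∈ N)
    (hs : ∀ w, ∃ v ∈ homVec K (Fin 3) ι d, Θ v = w) :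
    Module.finrank K ((homVec K (Fin 3) ι d).map (N.mkQ.restrictScalars K)) =
      Module.finrank K V' := by
  have h1 := finrank_map_add_finrank_inf_ker Θ (homVec K (Fin 3) ι d)
  have h2 := finrank_map_add_finrank_inf_ker (N.mkQ.restrictScalars K) (homVec K (Fin 3) ι d)
  have h3 : (homVec K (Fin 3) ι d).map Θ = ⊤ := by
    rw [eq_top_iff]
    intro w _
    exact hs w
  have h4 : homVec K (Fin 3) ι d ⊓ LinearMap.ker Θ =
      homVec K (Fin 3) ι d ⊓ LinearMap.ker (N.mkQ.restrictScalars K) := by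
    ext v
    rw [Submodule.mem_inf, Submodule.mem_inf]
    refine and_congr_right fun hv => ?_
    rw [LinearMap.mem_ker, h0 v hv, LinearMap.mem_ker, LinearMap.restrictScalars_apply,
      Submodule.mkQ_apply, Submodule.Quotient.mk_eq_zero]
  rw [h3, finrank_top, h4] at h1
  omega

/-- The linear conditions that cut out the piece of degree `d` of `closedMod K a c`. -/
def closedCoeff (K : Type*) [Field K] (d a c : ℕ) : (Fin 3 → MvPolynomial (Fin 3) K) →ₗ[K]
    (LowIndex c → K) × (LowIndex a → K) × (LowIndex a → K) × (Fin a → K) :=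
  (lowCoeff K d c ∘ₗ LinearMap.proj 0).prod ((lowCoeff K d a ∘ₗ LinearMap.proj 1).prod
    ((lowCoeff K d a ∘ₗ LinearMap.proj 2).prod (LinearMap.pi fun i : Fin a =>
      lcoeff K (expo (d - 1) i (a - 1 - i)) ∘ₗ
        ((pderiv 2).toLinearMap ∘ₗ LinearMap.proj 1 - (pderiv 1).toLinearMap ∘ₗ LinearMap.proj 2))))

theorem closedCoeff_apply (d a c : ℕ) (v : Fin 3 → MvPolynomial (Fin 3) K) :
    closedCoeff K d a c v = (lowCoeff K d c (v 0), lowCoeff K d a (v 1), lowCoeff K d a (v 2),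
      fun i : Fin a => coeff (expo (d - 1) i (a - 1 - i)) (pderiv 2 (v 1) - pderiv 1 (v 2))) := rfl

theorem expo_add_one {d i j : ℕ} (h : i + j < d) :
    expo (d - 1) i j + Finsupp.single 1 1 = expo d (i + 1) j := by
  ext x
  fin_cases x
  · simp; omega
  · simp
  · simp

theorem expo_add_two {d i j : ℕ} (h : i + j < d) :
    expo (d - 1) i j + Finsupp.single 2 1 = expo d i (j + 1) := by
  ext x
  fin_cases x
  · simp; omega
  · simp
  · simp

/-- Once `v 1` and `v 2` have order `a`, the difference ∂_2 v_1 - ∂_1 v_2 has order at least a - 1.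
Only its `a` coefficients of order exactly a - 1 remain as conditions. -/
theorem closedCoeff_eq_zero_iff {d a c : ℕ} {v : Fin 3 → MvPolynomial (Fin 3) K}
    (hv : v ∈ homVec K (Fin 3) (Fin 3) d) : closedCoeff K d a c v = 0 ↔ v ∈ closedMod K a c := by
  have hv' := mem_homVec.1 hv
  rw [closedCoeff_apply, mem_closedMod, ← lowCoeff_eq_zero_iff (hv' 0),
    ← lowCoeff_eq_zero_iff (hv' 1), ← lowCoeff_eq_zero_iff (hv' 2)]
  simp only [Prod.mk_eq_zero]
  refine and_congr_right fun _ => and_congr_right fun h1 => and_congr_right fun h2 => ?_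
  have hhom : (pderiv 2 (v 1) - pderiv 1 (v 2)).IsHomogeneous (d - 1) :=
    (hv' 1).pderiv.sub (hv' 2).pderiv
  constructor
  · intro h
    rw [mem_axisIdeal_pow]
    intro α hα
    rcases Nat.lt_or_ge (α 1 + α 2) (a - 1) with hlt | hge
    · obtain ⟨a, rfl⟩ : ∃ a', a = a' + 1 := ⟨a - 1, by omega⟩
      rw [lowCoeff_eq_zero_iff (hv' 1)] at h1
      rw [lowCoeff_eq_zero_iff (hv' 2)] at h2
      exact mem_axisIdeal_pow.1 (sub_mem (pderiv_mem_pow 2 a h1) (pderiv_mem_pow 1 a h2)) α hlt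
    · by_cases hd : α.degree = d - 1
      · have := congrFun h ⟨α 1, by omega⟩
        rw [eq_expo hd]
        rw [show α 2 = a - 1 - α 1 by omega]
        exact this
      · exact hhom.coeff_eq_zero hd
  · intro h
    ext i
    refine mem_axisIdeal_pow.1 h _ ?_
    have := i.2
    simp only [expo_one, expo_two]
    omega

theorem closedCoeff_surjective [CharZero K] {d a c : ℕ} (ha : a ≤ d) (hc : c ≤ d + 1)
    (w : (LowIndex c → K) × (LowIndex a → K) × (LowIndex a → K) × (Fin a → K)) :
    ∃ v ∈ homVec K (Fin 3) (Fin 3) d, closedCoeff K d a c v = w := by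
  obtain ⟨β₀, β₁, β₂, γ⟩ := w
  have hlow : ∀ (a' : ℕ) (ha' : a' ≤ d + 1) (β : LowIndex a' → K) (h : ℕ → ℕ → K),
      (∀ i j, i + j < a' → h i j = 0) →
      lowCoeff K d a' (polyOf d fun i j => extendLow β i j + h i j) = β := by
    intro a' ha' β h hh
    ext p
    have h1 := p.1.2
    have h2 := p.2.2
    rw [lowCoeff_apply, coeff_polyOf _ (by omega), extendLow_apply, hh _ _ (by omega), add_zero]
  -- Coefficients of order exactly `a` in v_1 do not affect the low coefficients, so they are free
  -- to realise γ. Dividing by j undoes ∂_2, and j ≠ 0 because i < a.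
  let g : ℕ → ℕ → K := fun i j => if h : i < a ∧ i + j = a then γ ⟨i, h.1⟩ / j else 0
  refine ⟨![polyOf d fun i j => extendLow β₀ i j + 0, polyOf d fun i j => extendLow β₁ i j + g i j,
    polyOf d fun i j => extendLow β₂ i j + 0], mem_homVec.2 fun l => ?_, ?_⟩
  · fin_cases l <;> exact isHomogeneous_polyOf _ _
  · rw [closedCoeff_apply]
    simp only [Matrix.cons_val_zero, Matrix.cons_val_one, Matrix.cons_val]
    refine Prod.ext (hlow c hc β₀ _ fun _ _ _ => rfl) (Prod.ext (hlow a (by omega) β₁ g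
      fun i j hij => dif_neg (by omega)) (Prod.ext (hlow a (by omega) β₂ _ fun _ _ _ => rfl) ?_))
    ext ⟨i, hi⟩
    simp only [coeff_sub, coeff_pderiv]
    rw [expo_add_one (by omega), expo_add_two (by omega), coeff_polyOf _ (by omega),
      coeff_polyOf _ (by omega), extendLow_of_le _ (by omega), extendLow_of_le _ (by omega),
      show g i (a - 1 - i + 1) = γ ⟨i, hi⟩ / ((a - 1 - i + 1 : ℕ) : K) from dif_pos (by omega)]
    have : ((a - 1 - i + 1 : ℕ) : K) ≠ 0 := Nat.cast_ne_zero.2 (by omega)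
    simp only [expo_two, zero_add, add_zero, zero_mul, sub_zero]
    push_cast at this ⊢
    exact div_mul_cancel₀ _ this

theorem finrank_closed [CharZero K] {d a c : ℕ}
    {N : Submodule (MvPolynomial (Fin 3) K) (Fin 3 → MvPolynomial (Fin 3) K)}
    (hN : N = closedMod K a c) (ha : a ≤ d) (hc : c ≤ d + 1) :
    Module.finrank K ((homVec K (Fin 3) (Fin 3) d).map
      (N.mkQ.restrictScalars K)) =
      Fintype.card (LowIndex c) + 2 * Fintype.card (LowIndex a) + a := by
  rw [finrank_map_mkQ (closedCoeff K d a c) (fun v hv => hN ▸ closedCoeff_eq_zero_iff hv)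
    (closedCoeff_surjective ha hc)]
  simp only [Module.finrank_prod, Module.finrank_fintype_fun_eq_card, Fintype.card_fin]
  omega

theorem relDim_wedgeOne [CharZero K] {d a : ℕ} (hd : a ≤ d) :
    relDim (wedgeOne (Fin 3)) (axisIdeal K ^ (a + 1)) d =
      Fintype.card (LowIndex (a + 1)) + 2 * Fintype.card (LowIndex a) + a :=
  finrank_closed (relMod_wedgeOne a) hd (by omega)

theorem relDim_wedgeTwo [CharZero K] {d a : ℕ} (hd : a ≤ d) :
    relDim wedgeTwo (axisIdeal K ^ (a + 1)) d =
      Fintype.card (LowIndex a) + 2 * Fintype.card (LowIndex a) + a :=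
  finrank_closed (relMod_wedgeTwo a) hd (by omega)

theorem relDim_wedgeThree [CharZero K] {d a : ℕ} (hd : a ≤ d) :
    relDim wedgeThree (axisIdeal K ^ (a + 1)) d = Fintype.card (LowIndex a) := by
  rw [relDim, finrank_map_mkQ (lowCoeff K d a ∘ₗ LinearMap.proj 0),
    Module.finrank_fintype_fun_eq_card]
  · intro v hv
    rw [mem_relMod_wedgeThree]
    exact lowCoeff_eq_zero_iff (mem_homVec.1 hv 0)
  · intro β
    refine ⟨fun _ => polyOf d (extendLow β), mem_homVec.2 fun _ => isHomogeneous_polyOf _ _, ?_⟩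
    ext p
    have h1 := p.1.2
    have h2 := p.2.2
    rw [LinearMap.comp_apply, LinearMap.proj_apply, lowCoeff_apply, coeff_polyOf _ (by omega),
      extendLow_apply]

end LocalDimension

/-! ### Moving points and separating them by forms -/

section Points

attribute [local instance] MvPolynomial.gradedAlgebra

variable {K : Type u} [Field K]

theorem exists_linearEquiv_apply_eq {V : Type*} [AddCommGroup V] [Module K V]
    [FiniteDimensional K V] {x y : V} (hx : x ≠ 0) (hy : y ≠ 0) : ∃ A : V ≃ₗ[K] V, A x = y := by
  let f := (LinearEquiv.toSpanNonzeroSingleton K V x hx).symm ≪≫ₗ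
    LinearEquiv.toSpanNonzeroSingleton K V y hy
  obtain ⟨g, hg⟩ := Submodule.exists_linearEquiv_restrict_eq f
  refine ⟨g, ?_⟩
  have h1 : (LinearEquiv.toSpanNonzeroSingleton K V x hx).symm
      ⟨x, Submodule.mem_span_singleton_self x⟩ = 1 := by
    rw [LinearEquiv.symm_apply_eq]
    exact Subtype.ext (by simp)
  have := hg ⟨x, Submodule.mem_span_singleton_self x⟩
  simpa [f, h1] using this.symm

/-- The linear form with the values of a linear functional. -/
def linForm {σ : Type*} [Fintype σ] [DecidableEq σ] (f : (σ → K) →ₗ[K] K) : MvPolynomial σ K :=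
  ∑ j, C (f (Pi.single j 1)) * X j

section LinForm

variable {σ : Type*} [Fintype σ] [DecidableEq σ]

theorem eval_linForm (f : (σ → K) →ₗ[K] K) (v : σ → K) : eval v (linForm f) = f v := by
  conv_rhs => rw [pi_eq_sum_univ' v, map_sum]
  simp [linForm, mul_comm, Pi.single]

theorem isHomogeneous_linForm (f : (σ → K) →ₗ[K] K) : (linForm f).IsHomogeneous 1 :=
  IsHomogeneous.sum _ _ _ fun _ _ => isHomogeneous_C_mul_X _ _

/-- Substitution of a linear map into polynomials. -/
def linSubst (A : (σ → K) →ₗ[K] (σ → K)) : MvPolynomial σ K →ₐ[K] MvPolynomial σ K :=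
  aeval fun i => linForm (LinearMap.proj i ∘ₗ A)

theorem eval_linSubst (A : (σ → K) →ₗ[K] (σ → K)) (v : σ → K) (f : MvPolynomial σ K) :
    eval v (linSubst A f) = eval (A v) f := by
  induction f using MvPolynomial.induction_on with
  | C a => simp [linSubst]
  | add p q hp hq => simp [hp, hq]
  | mul_X p i hp =>
    have hX : linSubst A (X i) = linForm (LinearMap.proj i ∘ₗ A) := aeval_X _ _
    rw [map_mul, map_mul, hp, hX, eval_linForm, map_mul, eval_X]
    rfl

theorem isHomogeneous_linSubst (A : (σ → K) →ₗ[K] (σ → K)) {f : MvPolynomial σ K} {d : ℕ}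
    (hf : f.IsHomogeneous d) : (linSubst A f).IsHomogeneous d := by
  have := hf.aeval (S := K) (fun i => linForm (LinearMap.proj i ∘ₗ A))
    fun i => isHomogeneous_linForm _
  rwa [one_mul] at this

/-- Substitution of an invertible linear map into polynomials. -/
def linSubstEquiv [Infinite K] (A : (σ → K) ≃ₗ[K] (σ → K)) :
    MvPolynomial σ K ≃ₐ[K] MvPolynomial σ K :=
  AlgEquiv.ofAlgHom (linSubst A) (linSubst A.symm)
    -- Over an infinite field it suffices to compare values of polynomials.
    (AlgHom.ext fun f => MvPolynomial.funext fun v => by simp [eval_linSubst])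
    (AlgHom.ext fun f => MvPolynomial.funext fun v => by simp [eval_linSubst])

end LinForm

theorem isHomogeneous_pointIdeal {n : ℕ} (P : ℙ K (Fin (n + 1) → K)) :
    (pointIdeal P).IsHomogeneous (homogeneousSubmodule (Fin (n + 1)) K) :=
  Ideal.homogeneous_span _ _ fun _ hF => hF.1

theorem isHomogeneous_pow {σ : Type*} {I : Ideal (MvPolynomial σ K)}
    (hI : I.IsHomogeneous (homogeneousSubmodule σ K)) (m : ℕ) :
    (I ^ m).IsHomogeneous (homogeneousSubmodule σ K) := by
  induction m with
  | zero => rw [pow_zero, Ideal.one_eq_top]; exact Ideal.IsHomogeneous.top _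
  | succ m ih => rw [pow_succ]; exact ih.mul hI

/-- Subtracting a suitable multiple of `e` makes any form of degree `D` vanish at P, so these forms
lie in I_P + (e). The (m+1)-st power of this ideal lies in I_P^m + (e). -/
theorem idealOfVars_pow_le {n : ℕ} (P : ℙ K (Fin (n + 1) → K)) {e : MvPolynomial (Fin (n + 1)) K}
    {D : ℕ} (he : e.IsHomogeneous D) (h0 : eval P.rep e ≠ 0) (m : ℕ) :
    idealOfVars (Fin (n + 1)) K ^ (D * (m + 1)) ≤ pointIdeal P ^ m ⊔ Ideal.span {e} := by
  have h1 : idealOfVars (Fin (n + 1)) K ^ D ≤ pointIdeal P ⊔ Ideal.span {e} := by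
    rw [pow_idealOfVars_eq_span, Ideal.span_le]
    rintro _ ⟨α, hα, rfl⟩
    have hhom : (monomial α (1 : K)).IsHomogeneous D := isHomogeneous_monomial _ hα
    set c := eval P.rep (monomial α (1 : K)) / eval P.rep e
    change monomial α (1 : K) ∈ pointIdeal P ⊔ Ideal.span {e}
    rw [← sub_add_cancel (monomial α (1 : K)) (C c * e)]
    refine add_mem (Submodule.mem_sup_left (Ideal.subset_span ⟨⟨D, hhom.sub (he.C_mul c)⟩, ?_⟩))
      (Submodule.mem_sup_right (Ideal.mul_mem_left _ _ (Ideal.mem_span_singleton_self e)))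
    rw [map_sub, map_mul, eval_C, div_mul_cancel₀ _ h0, sub_self]
  rw [pow_mul]
  refine (Ideal.pow_right_mono h1 _).trans ?_
  simpa using Ideal.sup_pow_add_le_pow_sup_pow (I := pointIdeal P) (J := Ideal.span {e})
    (n := m) (m := 1)

theorem exists_separating_form {n : ℕ} {P Q : ℙ K (Fin (n + 1) → K)} (h : P ≠ Q) :
    ∃ L : MvPolynomial (Fin (n + 1)) K, L.IsHomogeneous 1 ∧ eval P.rep L = 0 ∧
      eval Q.rep L ≠ 0 := by
  have hQ : Q.rep ∉ Submodule.span K {P.rep} := by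
    intro hmem
    obtain ⟨c, hc⟩ := Submodule.mem_span_singleton.1 hmem
    apply h
    rw [← P.mk_rep, ← Q.mk_rep]
    exact ((Projectivization.mk_eq_mk_iff' K _ _ _ _).2 ⟨c, hc⟩).symm
  obtain ⟨f, hf, hker⟩ := Submodule.exists_le_ker_of_notMem hQ
  exact ⟨linForm f, isHomogeneous_linForm f,
    by rw [eval_linForm]; exact hker (Submodule.mem_span_singleton_self _),
    by rwa [eval_linForm]⟩

theorem exists_nonvanishing_form {n : ℕ} (P : ℙ K (Fin (n + 1) → K)) :
    ∃ L : MvPolynomial (Fin (n + 1)) K, L.IsHomogeneous 1 ∧ eval P.rep L ≠ 0 := by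
  obtain ⟨i, hi⟩ := Function.ne_iff.1 P.rep_nonzero
  exact ⟨X i, isHomogeneous_X _ _, by simpa using hi⟩

theorem relDim_fatIdeal {n s : ℕ} (P : Fin s → ℙ K (Fin (n + 1) → K))
    (hP : Function.Injective P) (m : Fin s → ℕ) {ι : Type*} [Finite ι] {k : ℕ}
    (b : ι → Fin k → Fin (n + 1)) (c : Fin s → ℕ) (N : ℕ)
    (hc : ∀ j, ∀ d ≥ N, relDim b (pointIdeal (P j) ^ m j) d = c j) :
    ∃ N' : ℕ, ∀ d ≥ N', relDim b (fatIdeal P m) d = ∑ j, c j := by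
  have hL : ∀ i j, ∃ L : MvPolynomial (Fin (n + 1)) K, L.IsHomogeneous 1 ∧
      (i ≠ j → eval (P i).rep L = 0) ∧ eval (P j).rep L ≠ 0 := by
    intro i j
    by_cases hij : i = j
    · obtain ⟨L, h1, h2⟩ := exists_nonvanishing_form (P j)
      exact ⟨L, h1, fun h => absurd hij h, h2⟩
    · obtain ⟨L, h1, h2, h3⟩ := exists_separating_form fun h => hij (hP h)
      exact ⟨L, h1, fun _ => h2, h3⟩
  choose L hhom hzero hne using hL
  -- The factor i = j does not vanish at P_j and only equalises the degrees. The exponent is m_i + 1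
  -- so that the derivatives of e_j still lie in I_{P_i}^{m_i}.
  let e : Fin s → MvPolynomial (Fin (n + 1)) K := fun j => ∏ i, L i j ^ (m i + 1)
  have he : ∀ j, (e j).IsHomogeneous (∑ i, (m i + 1)) := fun j =>
    IsHomogeneous.prod _ _ _ fun i _ => by simpa using (hhom i j).pow (m i + 1)
  have hLmem : ∀ i j, i ≠ j → L i j ∈ pointIdeal (P i) := fun i j hij =>
    Ideal.subset_span ⟨⟨1, hhom i j⟩, hzero i j hij⟩
  have hmem : ∀ i j, i ≠ j → e j ∈ pointIdeal (P i) ^ (m i + 1) := fun i j hij =>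
    Ideal.mem_of_dvd _
      (Finset.dvd_prod_of_mem (fun i => L i j ^ (m i + 1)) (Finset.mem_univ i))
      (Ideal.pow_mem_pow (hLmem i j hij) _)
  refine relDim_iInf b (fun j => pointIdeal (P j) ^ m j)
    (fun j => isHomogeneous_pow (isHomogeneous_pointIdeal (P j)) _) e he
    (fun i j hij => Ideal.pow_le_pow_right (Nat.le_succ _) (hmem i j hij))
    (fun i j hij x => pderiv_mem_pow x _ (hmem i j hij)) _
    (fun j => idealOfVars_pow_le (P j) (he j) ?_ (m j)) c N hc
  rw [map_prod]
  refine Finset.prod_ne_zero_iff.2 fun i _ => ?_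
  rw [map_pow]
  exact pow_ne_zero _ (hne i j)

/-- After substitution, a form vanishing at P vanishes at (1 : 0 : 0), so it has no pure power of
X_0 and lies in (X_1, X_2). -/
theorem map_pointIdeal [Infinite K] (P : ℙ K (Fin 3 → K)) (A : (Fin 3 → K) ≃ₗ[K] (Fin 3 → K))
    (hA : A (Pi.single 0 1) = P.rep) :
    (pointIdeal (n := 2) P).map (linSubstEquiv A) = axisIdeal K := by
  apply le_antisymm
  · rw [pointIdeal, Ideal.map_span, Ideal.span_le]
    rintro _ ⟨F, ⟨⟨d, hF⟩, h0⟩, rfl⟩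
    have h0' : eval (Pi.single 0 1) (linSubst A.toLinearMap F) = 0 := by
      rw [eval_linSubst, LinearEquiv.coe_coe, hA, h0]
    have hF' := isHomogeneous_linSubst A.toLinearMap hF
    change linSubst A.toLinearMap F ∈ axisIdeal K
    generalize linSubst A.toLinearMap F = G at *
    rw [← pow_one (axisIdeal K), mem_axisIdeal_pow]
    intro α hα
    by_cases hd : α.degree = d
    · rw [eval_eq', Finset.sum_eq_single α] at h0'
      · rw [Fin.prod_univ_three, show α 1 = 0 by omega, show α 2 = 0 by omega] at h0'
        simpa using h0'
      · intro β hβ hne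
        have hβd := hF'.degree_eq_sum_deg_support hβ
        have hor : β 1 ≠ 0 ∨ β 2 ≠ 0 := by
          by_contra! h
          apply hne
          rw [eq_expo hd, eq_expo (hβd.symm : β.degree = d), h.1, h.2, show α 1 = 0 by omega,
            show α 2 = 0 by omega]
        rw [Fin.prod_univ_three]
        rcases hor with h | h <;> simp [h]
      · intro hα
        rw [notMem_support_iff.1 hα, zero_mul]
    · exact hF'.coeff_eq_zero hd
  · rw [axisIdeal, Ideal.span_le]
    have key : ∀ x : Fin 3, x ≠ 0 → X x ∈ (pointIdeal (n := 2) P).map (linSubstEquiv A) := by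
      intro x hx
      have : linSubstEquiv A ((linSubstEquiv A).symm (X x)) = X x := AlgEquiv.apply_symm_apply _ _
      rw [← this]
      refine Ideal.mem_map_of_mem _ (Ideal.subset_span
        ⟨⟨1, isHomogeneous_linSubst A.symm.toLinearMap (isHomogeneous_X _ x)⟩, ?_⟩)
      change eval P.rep (linSubst A.symm.toLinearMap (X x)) = 0
      rw [eval_linSubst, ← hA]
      simp [hx]
    rintro _ (rfl | rfl)
    · exact key 1 (by decide)
    · exact key 2 (by decide)

/-- The graded pieces of the forms depend only on the ring and its grading. The quotient by I_P^m is
presented twice, directly and after the coordinate change; both induce the same grading, so the two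
relation modules give equal dimensions. -/
theorem relDim_pointIdeal_pow [Infinite K] (P : ℙ K (Fin 3 → K)) (m : ℕ) {ι : Type} [Fintype ι]
    [DecidableEq ι] {k : ℕ} (hk : 0 < k) {b : ι → Fin k → Fin 3} (hb : IsWedgeBasis.{u} b)
    (d : ℕ) : relDim b (pointIdeal (n := 2) P ^ m) d = relDim b (axisIdeal K ^ m) d := by
  obtain ⟨A, hA⟩ := exists_linearEquiv_apply_eq (K := K)
    (x := (Pi.single 0 1 : Fin 3 → K)) (by simp) P.rep_nonzero
  let E := linSubstEquiv A
  let π := Ideal.Quotient.mkₐ K (pointIdeal (n := 2) P ^ m)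
  let π' := π.comp E.symm.toAlgHom
  have hπ : Function.Surjective π := Ideal.Quotient.mkₐ_surjective K _
  have hπ' : Function.Surjective π' := hπ.comp E.symm.surjective
  have hker : RingHom.ker π = pointIdeal (n := 2) P ^ m := Ideal.Quotient.mkₐ_ker K _
  have hker' : RingHom.ker π' = axisIdeal K ^ m := by
    rw [← map_pointIdeal P A hA, ← Ideal.map_pow]
    ext f
    rw [RingHom.mem_ker, Ideal.mem_map_of_equiv]
    constructor
    · intro h
      exact ⟨E.symm f, hker ▸ RingHom.mem_ker.2 h, E.apply_symm_apply f⟩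
    · rintro ⟨g, hg, rfl⟩
      change π (E.symm (E g)) = 0
      rw [E.symm_apply_apply]
      exact RingHom.mem_ker.1 (hker.symm ▸ hg)
  have hpiece : imagePiece π' = imagePiece π := by
    ext d f
    constructor
    · rintro ⟨F, hF, rfl⟩
      exact ⟨E.symm F, isHomogeneous_linSubst _ hF, rfl⟩
    · rintro ⟨F, hF, rfl⟩
      refine ⟨E F, isHomogeneous_linSubst _ hF, ?_⟩
      change π (E.symm (E F)) = _
      rw [E.symm_apply_apply]
      rfl
  have h1 := finrank_formsPiece hπ hk hb d
  have h2 := finrank_formsPiece hπ' hk hb d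
  rw [hpiece, h1, hker, hker'] at h2
  exact h2

end Points

/-! ### Assembling the Hilbert polynomials -/

section Hilbert

variable {K : Type u} [Field K] [CharZero K] {s : ℕ}

theorem exists_relDim_fatIdeal_eq (P : Fin s → ℙ K (Fin 3 → K)) (hP : Function.Injective P)
    (m : Fin s → ℕ) (hm : ∀ j, 0 < m j) {ι : Type} [Fintype ι] [DecidableEq ι] {k : ℕ} (hk : 0 < k)
    {b : ι → Fin k → Fin 3} (hb : IsWedgeBasis.{u} b) (c : ℕ → ℕ)
    (hc : ∀ d a, a ≤ d → relDim b (axisIdeal K ^ (a + 1)) d = c a) :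
    ∃ N : ℕ, ∀ d ≥ N, relDim b (fatIdeal (n := 2) P m) d = ∑ j, c (m j - 1) := by
  refine relDim_fatIdeal (n := 2) P hP m b (fun j => c (m j - 1)) (∑ j, m j) fun j d hd => ?_
  rw [relDim_pointIdeal_pow (P j) (m j) hk hb]
  have h1 : m j ≤ ∑ j, m j := Finset.single_le_sum (fun _ _ => Nat.zero_le _) (Finset.mem_univ j)
  have h2 := hm j
  have h3 := hc d (m j - 1) (by omega)
  rwa [Nat.sub_add_cancel h2] at h3

theorem isHilbertPolynomial_formsPiece (P : Fin s → ℙ K (Fin 3 → K)) (hP : Function.Injective P)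
    (m : Fin s → ℕ) (hm : ∀ j, 0 < m j) {ι : Type} [Fintype ι] [DecidableEq ι] {k : ℕ} (hk : 0 < k)
    {b : ι → Fin k → Fin 3} (hb : IsWedgeBasis.{u} b) (c : ℕ → ℕ)
    (hc : ∀ d a, a ≤ d → relDim b (axisIdeal K ^ (a + 1)) d = c a) :
    IsHilbertPolynomial (formsPiece (coordPiece (n := 2) P m) k)
      (Polynomial.C (∑ j, (c (m j - 1) : ℚ))) := by
  let π := Ideal.Quotient.mkₐ K (fatIdeal (n := 2) P m)
  have hπ : Function.Surjective π := Ideal.Quotient.mkₐ_surjective K _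
  have hker : RingHom.ker π = fatIdeal (n := 2) P m := Ideal.Quotient.mkₐ_ker K _
  refine ⟨formsPiece_finite (π := π) hk hb, ?_⟩
  obtain ⟨N, hN⟩ := exists_relDim_fatIdeal_eq P hP m hm hk hb c hc
  refine ⟨N + k, fun d hd => ?_⟩
  obtain ⟨d, rfl⟩ : ∃ d', d = d' + k := ⟨d - k, by omega⟩
  have := finrank_formsPiece hπ hk hb d
  rw [hker, hN d (by omega)] at this
  rw [Polynomial.eval_C, ← Nat.cast_sum, ← this]
  rfl

theorem isHilbertPolynomial_kaehlerPiece (P : Fin s → ℙ K (Fin 3 → K))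
    (hP : Function.Injective P) (m : Fin s → ℕ) (hm : ∀ j, 0 < m j) (c : ℕ → ℕ)
    (hc : ∀ d a, a ≤ d → relDim (wedgeOne (Fin 3)) (axisIdeal K ^ (a + 1)) d = c a) :
    IsHilbertPolynomial (kaehlerPiece (coordPiece (n := 2) P m))
      (Polynomial.C (∑ j, (c (m j - 1) : ℚ))) := by
  let π := Ideal.Quotient.mkₐ K (fatIdeal (n := 2) P m)
  have hπ : Function.Surjective π := Ideal.Quotient.mkₐ_surjective K _
  have hker : RingHom.ker π = fatIdeal (n := 2) P m := Ideal.Quotient.mkₐ_ker K _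
  refine ⟨kaehlerPiece_finite (π := π), ?_⟩
  obtain ⟨N, hN⟩ := exists_relDim_fatIdeal_eq P hP m hm one_pos isWedgeBasis_wedgeOne c hc
  refine ⟨N + 1, fun d hd => ?_⟩
  obtain ⟨d, rfl⟩ : ∃ d', d = d' + 1 := ⟨d - 1, by omega⟩
  have := finrank_kaehlerPiece hπ d
  rw [hker, hN d (by omega)] at this
  rw [Polynomial.eval_C, ← Nat.cast_sum, ← this]
  rfl

end Hilbert

end FatPoint

end

theorem proposition4p1 {K : Type*} [Field K] [CharZero K] {s : ℕ}
    (P : Fin s → ℙ K (Fin (2 + 1) → K)) (hP : Function.Injective P)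
    (m : Fin s → ℕ) (hm : ∀ j, 0 < m j) :
    FatPoint.IsHilbertPolynomial
        (FatPoint.kaehlerPiece (FatPoint.coordPiece P m))
        (Polynomial.C (∑ j, (1 / 2 : ℚ) * (3 * (m j : ℚ) - 2) * ((m j : ℚ) + 1))) ∧
      FatPoint.IsHilbertPolynomial
        (FatPoint.formsPiece (FatPoint.coordPiece P m) 2)
        (Polynomial.C (∑ j, (1 / 2 : ℚ) * (3 * (m j : ℚ) + 2) * ((m j : ℚ) - 1))) ∧
      FatPoint.IsHilbertPolynomial
        (FatPoint.formsPiece (FatPoint.coordPiece P m) 3)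
        (Polynomial.C (∑ j, (1 / 2 : ℚ) * (m j : ℚ) * ((m j : ℚ) - 1))) := by
  have hcard : ∀ a : ℕ, (Fintype.card (FatPoint.LowIndex a) : ℚ) = a * (a + 1) / 2 := by
    intro a
    have := FatPoint.card_lowIndex a
    qify at this
    linarith
  have h1 := FatPoint.isHilbertPolynomial_kaehlerPiece P hP m hm _
    fun d a => FatPoint.relDim_wedgeOne (K := K) (d := d) (a := a)
  have h2 := FatPoint.isHilbertPolynomial_formsPiece P hP m hm two_pos
    FatPoint.isWedgeBasis_wedgeTwo _
    fun d a => FatPoint.relDim_wedgeTwo (K := K) (d := d) (a := a)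
  have h3 := FatPoint.isHilbertPolynomial_formsPiece P hP m hm three_pos
    FatPoint.isWedgeBasis_wedgeThree _
    fun d a => FatPoint.relDim_wedgeThree (K := K) (d := d) (a := a)
  refine ⟨?_, ?_, ?_⟩
  · convert h1 using 2
    refine Finset.sum_congr rfl fun j _ => ?_
    -- The local counts are indexed by a = m - 1; positivity of m removes the truncated subtraction.
    obtain ⟨a, ha⟩ : ∃ a, m j = a + 1 := ⟨m j - 1, by have := hm j; omega⟩
    rw [ha]
    push_cast [hcard, Nat.add_sub_cancel]
    ring
  · convert h2 using 2
    refine Finset.sum_congr rfl fun j _ => ?_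
    obtain ⟨a, ha⟩ : ∃ a, m j = a + 1 := ⟨m j - 1, by have := hm j; omega⟩
    rw [ha]
    push_cast [hcard, Nat.add_sub_cancel]
    ring
  · convert h3 using 2
    refine Finset.sum_congr rfl fun j _ => ?_
    obtain ⟨a, ha⟩ : ∃ a, m j = a + 1 := ⟨m j - 1, by have := hm j; omega⟩
    rw [ha]
    push_cast [hcard, Nat.add_sub_cancel]
    ring
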